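/- **Syntax.** Fix two disjoint denumerable sets of channel names $c,d$ and variables $x,y$; identifiers $u,v$ range over both. Fix also a denumerable set of process variables $X$. Processes (taken up to renaming of bound names and variables) are $$P,Q ::= u!\vec v.P \mid u?\vec x.P \mid \mathbf 0 \mid \mathsf{if}\ u=v\ \mathsf{then}\ P\ \mathsf{else}\ Q \mid \mathsf{rec}\,X.P \mid X \mid P\,\|\,Q \mid (\nu c{:}s)P \mid \mathsf{alloc}\,x.P \mid \mathsf{free}\,u.P,$$ where $s\in\{\top,\bot\}$ (allocated, deallocated), input binds the pairwise distinct variables $\vec x$, $\mathsf{alloc}$ binds $x$, scoping binds $c$, and $\mathsf{rec}$ binds $X$. A configuration $\langle\sigma,P\rangle$ is a partial map $\sigma$ from channel names to $\{\top,\bot\}$ and a process $P$ with $\mathrm{fn}(P)\subseteq\mathrm{dom}(\sigma)$; it is closed if $P$ has no free variables. **Reduction.** Structural equivalence $\equiv$ is the least congruence such that $\|$ is a commutative monoid with unit $\mathbf 0$; $P\equiv(\nu c{:}s)P$ and $P\,\|\,(\nu c{:}s)Q\equiv(\nu c{:}s)(P\,\|\,Q)$ if $c\notin\mathrm{fn}(P)$;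 and $(\nu c{:}s)(\nu d{:}t)P\equiv(\nu d{:}t)(\nu c{:}s)P$ for $c\ne d$. Reduction $\to$ is the least relation on closed configurations with - $\langle\sigma, c!\vec b.P\,\|\,c?\vec x.Q\rangle\to\langle\sigma,P\,\|\,Q\{\vec b/\vec x\}\rangle$ if $\sigma(c)=\top$ and $|\vec b|=|\vec x|$; - $\langle\sigma,\mathsf{rec}\,X.P\rangle\to\langle\sigma,P\{\mathsf{rec}\,X.P/X\}\rangle$; - $\langle\sigma,\mathsf{if}\ c=c\ \mathsf{then}\ P\ \mathsf{else}\ Q\rangle\to\langle\sigma,P\rangle$, and $\langle\sigma,\mathsf{if}\ c=d\ \mathsf{then}\ P\ \mathsf{else}\ Q\rangle\to\langle\sigma,Q\rangle$ if $c\neq d$; - $\langle\sigma,\mathsf{alloc}\,x.P\rangle\to\langle\sigma,(\nu c{:}\top)P\{c/x\}\rangle$ if $c\notin\mathrm{dom}(\sigma)$; - $\langle(\sigma,c{:}\top),\mathsf{free}\,c.P\rangle\to\langle(\sigma,c{:}\bot),P\rangle$; - if $P\equiv P'$, $\langle\sigma,P'\rangle\to\langle\sigma',Q'\rangle$ and $Q'\equiv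 Q$, then $\langle\sigma,P\rangle\to\langle\sigma',Q\rangle$; - if $\langle\sigma,P\rangle\to\langle\sigma',P'\rangle$, then $\langle\sigma,P\|Q\rangle\to\langle\sigma',P'\|Q\rangle$ and $\langle\sigma,Q\|P\rangle\to\langle\sigma',Q\|P'\rangle$; - if $\langle(\sigma,c{:}s),P\rangle\to\langle(\sigma',c{:}s'),P'\rangle$, then $\langle\sigma,(\nu c{:}s)P\rangle\to\langle\sigma',(\nu c{:}s')P'\rangle$. **Types.** Types are $T::=[\vec T]^a\mid\mathsf{proc}$ with attributes $a::=1$ (affine) $\mid\omega$ (unrestricted) $\mid(\bullet,i)$ (unique after $i\in\mathbb N$ steps); $\bullet=(\bullet,0)$. Environments $\Gamma$ are finite multisets of assumptions $u:T$ or $X:T$. The expression $\Gamma,u:[\vec T]^{a-1}$ means $\Gamma$ if $a=1$; $\Gamma,u:[\vec T]^{\omega}$ if $a=\omega$; $\Gamma,u:[\vec T]^{(\bullet,i)}$ if $a=(\bullet,i+1)$; it is undefined if $a=(\bullet,0)$. Splitting: $[\vec T]^\omega=[\vec T]^\omega\circ[\vec T]^\omega$, $\mathsf{proc}=\mathsf{proc}\circ\mathsf{proc}$,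 $[\vec T]^{(\bullet,i)}=[\vec T]^{1}\circ[\vec T]^{(\bullet,i+1)}$. Subtyping: $[\vec T]^{a_1}\preceq[\vec T]^{a_2}$ when $a_1\preceq a_2$, where $(\bullet,i)\preceq(\bullet,i+1)$, $(\bullet,i+1)\preceq\omega$, $\omega\preceq 1$. The relation $\Gamma\vdash P$ is the least one closed under the following rules, in which bound names and variables are fresh for the environment of the conclusion, and $\Gamma^\omega$ contains only assumptions of type $[\vec T]^\omega$ or $\mathsf{proc}$. - Logical rules: - if $\Gamma,u{:}[\vec T]^{a-1},\vec x{:}\vec T\vdash P$ then $\Gamma,u{:}[\vec T]^a\vdash u?\vec x.P$; - if $\Gamma,u{:}[\vec T]^{a-1}\vdash P$ then $\Gamma,u{:}[\vec T]^a,\vec v{:}\vec T\vdash u!\vec v.P$; - if $\Gamma_1\vdash P$ and $\Gamma_2\vdash Q$ then $\Gamma_1,\Gamma_2\vdash P\|Q$; - if $u,v\in\Gamma$, $\Gamma\vdash P$ and $\Gamma\vdash Q$ then $\Gamma\vdash\mathsf{if}\ u=v\ \mathsf{then}\ P\ \mathsf{else}\ Q$; - if $\Gamma^\omega,X{:}\mathsf{proc}\vdash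 P$ then $\Gamma^\omega\vdash\mathsf{rec}\,X.P$; - $X{:}\mathsf{proc}\vdash X$; - if $\Gamma,x{:}[\vec T]^{\bullet}\vdash P$ then $\Gamma\vdash\mathsf{alloc}\,x.P$; - if $\Gamma\vdash P$ then $\Gamma,u{:}[\vec T]^{\bullet}\vdash\mathsf{free}\,u.P$; - $\emptyset\vdash\mathbf 0$; - if $\Gamma,c{:}T\vdash P$ then $\Gamma\vdash(\nu c{:}\top)P$; - if $\Gamma\vdash P$ then $\Gamma\vdash(\nu c{:}\bot)P$. - Structural rules (for $w$ an identifier or a process variable): - if $T=T_1\circ T_2$ and $\Gamma,w{:}T_1,w{:}T_2\vdash P$ then $\Gamma,w{:}T\vdash P$; - if $\Gamma\vdash P$ then $\Gamma,w{:}T\vdash P$; - if $\Gamma,w{:}T_2\vdash P$ and $T_1\preceq T_2$ then $\Gamma,w{:}T_1\vdash P$; - if $\Gamma,w{:}[\vec T_2]^{\bullet}\vdash P$ then $\Gamma,w{:}[\vec T_1]^{\bullet}\vdash P$. Finally, for a configuration $\langle\sigma,P\rangle$, write $\Gamma\vdash\langle\sigma,P\rangle$ if $\Gamma\vdash P$,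 $\Gamma$ is a partial map (at most one assumption for each identifier or process variable), and $\sigma(c)=\top$ for every channel $c$ in the domain of $\Gamma$. **Theorem (Subject reduction).** If $\Gamma\vdash\langle\sigma,P\rangle$ and $\langle\sigma,P\rangle\to\langle\sigma',P'\rangle$, then there exists an environment $\Gamma'$ such that $\Gamma'\vdash\langle\sigma',P'\rangle$. -/

import Mathlib

/- Processes are represented up to renaming of bound names and variables by de Bruijn indices, with
separate index spaces for channel names, variables and process variables.  Below `k` binders of one
sort the index `i < k` is the `i`-th enclosing bound one, and `k + i` is the free one numbered `i`.
The denumerable sets of channel names, variables and process variables are thus copies of `ℕ`, and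
"`c` is fresh for `P`" is expressed by shifting the channel indices of `P` by one. -/

namespace PiR

/-- The state of a channel: allocated or deallocated. -/
inductive CState where
  | top
  | bot

/-- Identifiers `u, v`: channel names `c, d` or variables `x, y`. -/
inductive Ident where
  | chan (c : ℕ)
  | var (x : ℕ)

/-- Processes of the polyadic pi-calculus with allocation, deallocation and stateful scoping. -/
inductive Proc where
  /-- output `u!(v₁, …, vₙ).P` -/
  | out (u : Ident) (vs : List Ident) (P : Proc)
  /-- input `u?(x₁, …, xₙ).P`, binding the `n` variables with indices `0, …, n - 1` in `P` -/
  | inp (u : Ident) (n : ℕ) (P : Proc)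
  | nil
  /-- match `if u = v then P else Q` -/
  | ite (u v : Ident) (P Q : Proc)
  /-- recursion `rec X. P`, binding the process variable with index `0` in `P` -/
  | recX (P : Proc)
  | pvar (X : ℕ)
  | par (P Q : Proc)
  /-- stateful scoping `(ν c : s) P`, binding the channel with index `0` in `P` -/
  | res (s : CState) (P : Proc)
  /-- allocation `alloc x. P`, binding the variable with index `0` in `P` -/
  | alloc (P : Proc)
  /-- deallocation `free u. P` -/
  | free (u : Ident) (P : Proc)

/-! ### Renaming and substitution -/

/-- Make room for `n` newly bound variables. -/
def shiftVar (n : ℕ) : Ident → Ident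
  | .chan c => .chan c
  | .var x => .var (n + x)

/-- Make room for one newly bound channel. -/
def shiftChan : Ident → Ident
  | .chan c => .chan (c + 1)
  | .var x => .var x

/-- Carry a substitution of identifiers for identifiers under a binder of `n` variables. -/
def liftVar (n : ℕ) (f : Ident → Ident) : Ident → Ident
  | .chan c => shiftVar n (f (.chan c))
  | .var x => if x < n then .var x else shiftVar n (f (.var (x - n)))

/-- Carry a substitution of identifiers for identifiers under a binder of one channel. -/
def liftChan (f : Ident → Ident) : Ident → Ident
  | .chan 0 => .chan 0
  | .chan (c + 1) => shiftChan (f (.chan c))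
  | .var x => shiftChan (f (.var x))

/-- Simultaneous capture-avoiding substitution of identifiers for identifiers. -/
def Proc.subst : (Ident → Ident) → Proc → Proc
  | f, .out u vs P => .out (f u) (vs.map f) (P.subst f)
  | f, .inp u n P => .inp (f u) n (P.subst (liftVar n f))
  | _, .nil => .nil
  | f, .ite u v P Q => .ite (f u) (f v) (P.subst f) (Q.subst f)
  | f, .recX P => .recX (P.subst f)
  | _, .pvar X => .pvar X
  | f, .par P Q => .par (P.subst f) (Q.subst f)
  | f, .res s P => .res s (P.subst (liftChan f))
  | f, .alloc P => .alloc (P.subst (liftVar 1 f))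
  | f, .free u P => .free (f u) (P.subst f)

/-- Carry a renaming of process variables under a binder of one process variable. -/
def liftRen (r : ℕ → ℕ) : ℕ → ℕ
  | 0 => 0
  | X + 1 => r X + 1

/-- Renaming of process variables. -/
def Proc.renP : (ℕ → ℕ) → Proc → Proc
  | r, .out u vs P => .out u vs (P.renP r)
  | r, .inp u n P => .inp u n (P.renP r)
  | _, .nil => .nil
  | r, .ite u v P Q => .ite u v (P.renP r) (Q.renP r)
  | r, .recX P => .recX (P.renP (liftRen r))
  | r, .pvar X => .pvar (r X)
  | r, .par P Q => .par (P.renP r) (Q.renP r)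
  | r, .res s P => .res s (P.renP r)
  | r, .alloc P => .alloc (P.renP r)
  | r, .free u P => .free u (P.renP r)

/-- Carry a substitution of processes for process variables under a binder of one of these. -/
def liftProc (t : ℕ → Proc) : ℕ → Proc
  | 0 => .pvar 0
  | X + 1 => (t X).renP Nat.succ

/-- Simultaneous capture-avoiding substitution of processes for process variables. -/
def Proc.substP : (ℕ → Proc) → Proc → Proc
  | t, .out u vs P => .out u vs (P.substP t)
  | t, .inp u n P => .inp u n (P.substP fun X => (t X).subst (shiftVar n))
  | _, .nil => .nil
  | t, .ite u v P Q => .ite u v (P.substP t) (Q.substP t)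
  | t, .recX P => .recX (P.substP (liftProc t))
  | t, .pvar X => t X
  | t, .par P Q => .par (P.substP t) (Q.substP t)
  | t, .res s P => .res s (P.substP fun X => (t X).subst shiftChan)
  | t, .alloc P => .alloc (P.substP fun X => (t X).subst (shiftVar 1))
  | t, .free u P => .free u (P.substP t)

/-- `P{b₁, …, bₙ / x₁, …, xₙ}` is `P.subst (instArgs [b₁, …, bₙ])`, for `P` under a binder of the
variables `x₁, …, xₙ`. -/
def instArgs (bs : List ℕ) : Ident → Ident
  | .chan c => .chan c
  | .var x => if h : x < bs.length then .chan bs[x] else .var (x - bs.length)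

/-- `P{c / x}` is `P.subst instFresh`, for `P` under a binder of the variable `x`, where `c` is a
fresh channel, bound by a scoping around the result. -/
def instFresh : Ident → Ident
  | .chan c => .chan (c + 1)
  | .var 0 => .chan 0
  | .var (x + 1) => .var x

/-- `P{R / X}` is `P.substP (instProc R)`, for `P` under a binder of the process variable `X`. -/
def instProc (R : Proc) : ℕ → Proc
  | 0 => R
  | X + 1 => .pvar X

/-- Exchange of the two innermost bound channels. -/
def swapChan : Ident → Ident
  | .chan 0 => .chan 1
  | .chan 1 => .chan 0
  | u => u

/-! ### Free names and free variables -/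

def Ident.names : Ident → Set ℕ
  | .chan c => {c}
  | .var _ => ∅

def Ident.vars : Ident → Set ℕ
  | .chan _ => ∅
  | .var x => {x}

/-- The free channel names of a process. -/
def Proc.fn : Proc → Set ℕ
  | .out u vs P => u.names ∪ {c | ∃ v ∈ vs, c ∈ v.names} ∪ P.fn
  | .inp u _ P => u.names ∪ P.fn
  | .nil => ∅
  | .ite u v P Q => u.names ∪ v.names ∪ P.fn ∪ Q.fn
  | .recX P => P.fn
  | .pvar _ => ∅
  | .par P Q => P.fn ∪ Q.fn
  | .res _ P => {c | c + 1 ∈ P.fn}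
  | .alloc P => P.fn
  | .free u P => u.names ∪ P.fn

/-- The free variables of a process. -/
def Proc.fv : Proc → Set ℕ
  | .out u vs P => u.vars ∪ {x | ∃ v ∈ vs, x ∈ v.vars} ∪ P.fv
  | .inp u n P => u.vars ∪ {x | n + x ∈ P.fv}
  | .nil => ∅
  | .ite u v P Q => u.vars ∪ v.vars ∪ P.fv ∪ Q.fv
  | .recX P => P.fv
  | .pvar _ => ∅
  | .par P Q => P.fv ∪ Q.fv
  | .res _ P => P.fv
  | .alloc P => {x | 1 + x ∈ P.fv}
  | .free u P => u.vars ∪ P.fv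

/-! ### Structural equivalence -/

/-- Structural equivalence: the least congruence that makes parallel composition a commutative
monoid with unit `nil` and satisfies the three scoping laws.  A process in which the scoped channel
does not occur free is one of the form `P.subst shiftChan`. -/
inductive SEq : Proc → Proc → Prop
  | refl (P : Proc) : SEq P P
  | symm {P Q : Proc} : SEq P Q → SEq Q P
  | trans {P Q R : Proc} : SEq P Q → SEq Q R → SEq P R
  | parNil (P : Proc) : SEq (.par P .nil) P
  | parComm (P Q : Proc) : SEq (.par P Q) (.par Q P)
  | parAssoc (P Q R : Proc) : SEq (.par (.par P Q) R) (.par P (.par Q R))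
  /-- `P ≡ (ν c : s) P` if `c` is not free in `P` -/
  | scope (s : CState) (P : Proc) : SEq P (.res s (P.subst shiftChan))
  /-- `P | (ν c : s) Q ≡ (ν c : s) (P | Q)` if `c` is not free in `P` -/
  | extrude (s : CState) (P Q : Proc) :
      SEq (.par P (.res s Q)) (.res s (.par (P.subst shiftChan) Q))
  /-- `(ν c : s) (ν d : t) P ≡ (ν d : t) (ν c : s) P` -/
  | swap (s t : CState) (P : Proc) :
      SEq (.res s (.res t P)) (.res t (.res s (P.subst swapChan)))
  | out (u : Ident) (vs : List Ident) {P P' : Proc} : SEq P P' → SEq (.out u vs P) (.out u vs P')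
  | inp (u : Ident) (n : ℕ) {P P' : Proc} : SEq P P' → SEq (.inp u n P) (.inp u n P')
  | ite (u v : Ident) {P P' Q Q' : Proc} :
      SEq P P' → SEq Q Q' → SEq (.ite u v P Q) (.ite u v P' Q')
  | recX {P P' : Proc} : SEq P P' → SEq (.recX P) (.recX P')
  | par {P P' Q Q' : Proc} : SEq P P' → SEq Q Q' → SEq (.par P Q) (.par P' Q')
  | res (s : CState) {P P' : Proc} : SEq P P' → SEq (.res s P) (.res s P')
  | alloc {P P' : Proc} : SEq P P' → SEq (.alloc P) (.alloc P')
  | free (u : Ident) {P P' : Proc} : SEq P P' → SEq (.free u P) (.free u P')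

/-! ### Configurations and reduction -/

/-- Partial maps `σ` from channel names to channel states. -/
abbrev Store := ℕ → Option CState

/-- `σ, c : s` for a newly bound channel `c`. -/
def Store.cons (s : CState) (σ : Store) : Store
  | 0 => some s
  | c + 1 => σ c

/-- Pairs `⟨σ, P⟩`. -/
structure Config where
  store : Store
  proc : Proc

/-- `⟨σ, P⟩` is a configuration: the free names of `P` lie in the domain of `σ`. -/
def Config.IsConfig (C : Config) : Prop :=
  ∀ c ∈ C.proc.fn, ∃ s, C.store c = some s

/-- The configuration is closed: `P` has no free variables. -/
def Config.Closed (C : Config) : Prop :=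
  C.proc.fv = ∅

/-- The reduction rules, closed under structural equivalence and under the contexts
`C ::= [-] | C | P | P | C | (ν c) C`; the last of these moves the state of `c` between the store
and the scoping construct. -/
inductive Step : Config → Config → Prop
  | com {σ : Store} {c : ℕ} (bs : List ℕ) (P Q : Proc) :
      σ c = some .top →
      Step ⟨σ, .par (.out (.chan c) (bs.map Ident.chan) P) (.inp (.chan c) bs.length Q)⟩
        ⟨σ, .par P (Q.subst (instArgs bs))⟩
  | unfold (σ : Store) (P : Proc) :
      Step ⟨σ, .recX P⟩ ⟨σ, P.substP (instProc (.recX P))⟩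
  | thenBranch (σ : Store) (c : ℕ) (P Q : Proc) :
      Step ⟨σ, .ite (.chan c) (.chan c) P Q⟩ ⟨σ, P⟩
  | elseBranch (σ : Store) {c d : ℕ} (P Q : Proc) :
      c ≠ d → Step ⟨σ, .ite (.chan c) (.chan d) P Q⟩ ⟨σ, Q⟩
  | alloc (σ : Store) (P : Proc) :
      Step ⟨σ, .alloc P⟩ ⟨σ, .res .top (P.subst instFresh)⟩
  | free {σ : Store} {c : ℕ} (P : Proc) :
      σ c = some .top →
      Step ⟨σ, .free (.chan c) P⟩ ⟨Function.update σ c (some .bot), P⟩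
  | struct {σ σ' : Store} {P P' Q Q' : Proc} :
      SEq P P' → Step ⟨σ, P'⟩ ⟨σ', Q'⟩ → SEq Q' Q → Step ⟨σ, P⟩ ⟨σ', Q⟩
  | parLeft {σ σ' : Store} {P P' : Proc} (Q : Proc) :
      Step ⟨σ, P⟩ ⟨σ', P'⟩ → Step ⟨σ, .par P Q⟩ ⟨σ', .par P' Q⟩
  | parRight {σ σ' : Store} {P P' : Proc} (Q : Proc) :
      Step ⟨σ, P⟩ ⟨σ', P'⟩ → Step ⟨σ, .par Q P⟩ ⟨σ', .par Q P'⟩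
  | res {σ σ' : Store} {s s' : CState} {P P' : Proc} :
      Step ⟨σ.cons s, P⟩ ⟨σ'.cons s', P'⟩ → Step ⟨σ, .res s P⟩ ⟨σ', .res s' P'⟩

/-- Reduction of closed configurations. -/
def Config.Reduces (C C' : Config) : Prop :=
  C.IsConfig ∧ C.Closed ∧ Step C C'

/-! ### Types and environments -/

/-- Usage attributes: affine, unrestricted, unique after `i` steps. -/
inductive Attr where
  | aff
  | unr
  | unq (i : ℕ)

/-- Types: channel types `[T₁, …, Tₙ]ᵃ` and the type of processes. -/
inductive Ty where
  | chan (Ts : List Ty) (a : Attr)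
  | proc

/-- What a typing assumption can be about: an identifier or a process variable. -/
inductive Key where
  | id (u : Ident)
  | pvar (X : ℕ)

/-- Typing environments are multisets of typing assumptions. -/
abbrev Env := Multiset (Key × Ty)

def Key.subst (f : Ident → Ident) : Key → Key
  | .id u => .id (f u)
  | .pvar X => .pvar X

def Key.shiftP : Key → Key
  | .id u => .id u
  | .pvar X => .pvar (X + 1)

def Env.subst (f : Ident → Ident) (Γ : Env) : Env :=
  Γ.map fun p => (p.1.subst f, p.2)

/-- Make room for one newly bound process variable. -/
def Env.shiftP (Γ : Env) : Env :=
  Γ.map fun p => (p.1.shiftP, p.2)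

/-- The assumptions `u₁ : T₁, …, uₙ : Tₙ`, for two lists of the same length. -/
def Env.args (us : List Ident) (Ts : List Ty) : Env :=
  ((us.map Key.id).zip Ts : List (Key × Ty))

/-- Channel usage: `Γ, u : [Ts]^(a - 1)`; it is undefined for `a` unique after `0` steps. -/
inductive Uses (Γ : Env) (u : Ident) (Ts : List Ty) : Attr → Env → Prop
  | aff : Uses Γ u Ts .aff Γ
  | unr : Uses Γ u Ts .unr ((.id u, .chan Ts .unr) ::ₘ Γ)
  | unq (i : ℕ) : Uses Γ u Ts (.unq (i + 1)) ((.id u, .chan Ts (.unq i)) ::ₘ Γ)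

/-- Type splitting `T = T₁ ∘ T₂`. -/
inductive Split : Ty → Ty → Ty → Prop
  | unr (Ts : List Ty) : Split (.chan Ts .unr) (.chan Ts .unr) (.chan Ts .unr)
  | proc : Split .proc .proc .proc
  | unq (Ts : List Ty) (i : ℕ) :
      Split (.chan Ts (.unq i)) (.chan Ts .aff) (.chan Ts (.unq (i + 1)))

/-- Subtyping of attributes. -/
inductive SubAttr : Attr → Attr → Prop
  | indx (i : ℕ) : SubAttr (.unq i) (.unq (i + 1))
  | unq (i : ℕ) : SubAttr (.unq (i + 1)) .unr
  | aff : SubAttr .unr .aff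

/-- Subtyping. -/
inductive SubTy : Ty → Ty → Prop
  | typ (Ts : List Ty) {a₁ a₂ : Attr} : SubAttr a₁ a₂ → SubTy (.chan Ts a₁) (.chan Ts a₂)

/-- Unrestricted assumptions: unrestricted channels and process variables, the assumptions that can
be split into copies of themselves. -/
inductive Ty.Unrestricted : Ty → Prop
  | chan (Ts : List Ty) : Ty.Unrestricted (.chan Ts .unr)
  | proc : Ty.Unrestricted .proc

/-- The typing relation `Γ ⊢ P`: logical rules, then structural rules. -/
inductive Typed : Env → Proc → Prop
  | inp {Γ Δ : Env} {u : Ident} {Ts : List Ty} {a : Attr} {P : Proc} :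
      Uses Γ u Ts a Δ →
      Typed (Env.subst (shiftVar Ts.length) Δ
        + Env.args ((List.range Ts.length).map Ident.var) Ts) P →
      Typed ((.id u, .chan Ts a) ::ₘ Γ) (.inp u Ts.length P)
  | out {Γ Δ : Env} {u : Ident} {vs : List Ident} {Ts : List Ty} {a : Attr} {P : Proc} :
      vs.length = Ts.length →
      Uses Γ u Ts a Δ →
      Typed Δ P →
      Typed ((.id u, .chan Ts a) ::ₘ (Γ + Env.args vs Ts)) (.out u vs P)
  | par {Γ₁ Γ₂ : Env} {P Q : Proc} :
      Typed Γ₁ P → Typed Γ₂ Q → Typed (Γ₁ + Γ₂) (.par P Q)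
  | ite {Γ : Env} {u v : Ident} {P Q : Proc} :
      (∃ T, (Key.id u, T) ∈ Γ) → (∃ T, (Key.id v, T) ∈ Γ) →
      Typed Γ P → Typed Γ Q → Typed Γ (.ite u v P Q)
  | recX {Γ : Env} {P : Proc} :
      (∀ p ∈ Γ, p.2.Unrestricted) →
      Typed ((.pvar 0, .proc) ::ₘ Γ.shiftP) P →
      Typed Γ (.recX P)
  | pvar (X : ℕ) : Typed {(.pvar X, .proc)} (.pvar X)
  | alloc {Γ : Env} {Ts : List Ty} {P : Proc} :
      Typed ((.id (.var 0), .chan Ts (.unq 0)) ::ₘ Γ.subst (shiftVar 1)) P →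
      Typed Γ (.alloc P)
  | free {Γ : Env} {u : Ident} {Ts : List Ty} {P : Proc} :
      Typed Γ P → Typed ((.id u, .chan Ts (.unq 0)) ::ₘ Γ) (.free u P)
  | nil : Typed 0 .nil
  | resTop {Γ : Env} {T : Ty} {P : Proc} :
      Typed ((.id (.chan 0), T) ::ₘ Γ.subst shiftChan) P →
      Typed Γ (.res .top P)
  | resBot {Γ : Env} {P : Proc} :
      Typed (Γ.subst shiftChan) P → Typed Γ (.res .bot P)
  | con {Γ : Env} {k : Key} {T T₁ T₂ : Ty} {P : Proc} :
      Split T T₁ T₂ →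
      Typed ((k, T₁) ::ₘ (k, T₂) ::ₘ Γ) P →
      Typed ((k, T) ::ₘ Γ) P
  | weak {Γ : Env} {k : Key} {T : Ty} {P : Proc} :
      Typed Γ P → Typed ((k, T) ::ₘ Γ) P
  | sub {Γ : Env} {k : Key} {T₁ T₂ : Ty} {P : Proc} :
      Typed ((k, T₂) ::ₘ Γ) P → SubTy T₁ T₂ → Typed ((k, T₁) ::ₘ Γ) P
  | rev {Γ : Env} {k : Key} {Ts₁ Ts₂ : List Ty} {P : Proc} :
      Typed ((k, .chan Ts₂ (.unq 0)) ::ₘ Γ) P →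
      Typed ((k, .chan Ts₁ (.unq 0)) ::ₘ Γ) P

/-- `Γ` is a partial map: it has at most one assumption for each identifier or process variable. -/
def Env.IsPartialMap (Γ : Env) : Prop :=
  (Γ.map Prod.fst).Nodup

/-- The typing relation `Γ ⊢ ⟨σ, P⟩` for configurations. -/
structure TypedConfig (Γ : Env) (C : Config) : Prop where
  isConfig : C.IsConfig
  allocated : ∀ (c : ℕ) (T : Ty), (Key.id (.chan c), T) ∈ Γ → C.store c = some .top
  typed : Typed Γ C.proc
  partialMap : Γ.IsPartialMap

end PiR

namespace PiR

/-! ### Environments -/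

/-! The structural rules see only the environment, so every derivation ends with a block of them
applied below one logical rule. With such blocks collected in the relation `Structural`, typing can
be inverted up to a structural residue (`Typed.inversion`). Together with the substitution lemmas
`Typed.subst` and `Typed.substP` and with strengthening `Typed.erase`, inversion shows that
structurally equivalent processes are typed in exactly the same environments (`SEq.typed_iff`).

Inversion splits assumptions, so the environments inside the argument are not partial maps. The
invariant that replaces this is `Env.Valid`: domain channels are allocated, and the types of each
key are `Coherent`, that is, all `proc`, or unrestricted and affine with one payload, or one type
unique after `i` steps accompanied by at most `i` affine ones. Partial maps are coherent
(`Env.IsPartialMap.coherent`), and structural rules read from conclusion to premise preserve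
validity (`Structural.valid`). Conversely, coherent types descend from a single type
(`Coherent.exists_structural`), which recovers a partial map at the end (`Env.exists_isPartialMap`).

Coherence is what makes the two critical reductions sound. In a communication both ends agree on the
payload, and their joint use of a unique channel removes an affine assumption while the counter
drops by one (`Env.Valid.uses`). In a deallocation, uniqueness after `0` steps excludes every other
assumption about the channel, so its state may change (`Env.Valid.free`).

The induction on reduction, `Step.typed`, carries a frame: the assumptions of the surrounding
context, with which the environment of the reduct must stay jointly coherent. Validity of the
components separately would not be enough to recombine them. -/

theorem Env.subst_cons (f : Ident → Ident) (k : Key) (T : Ty) (Γ : Env) :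
    Env.subst f ((k, T) ::ₘ Γ) = (k.subst f, T) ::ₘ Env.subst f Γ := by
  simp [Env.subst]

theorem Env.subst_add (f : Ident → Ident) (Γ Δ : Env) :
    Env.subst f (Γ + Δ) = Env.subst f Γ + Env.subst f Δ := by
  simp [Env.subst]

theorem Key.subst_subst (f g : Ident → Ident) (k : Key) :
    (k.subst f).subst g = k.subst (g ∘ f) := by
  cases k <;> rfl

theorem Key.subst_id (k : Key) : k.subst _root_.id = k := by
  cases k <;> rfl

theorem Env.subst_subst (f g : Ident → Ident) (Γ : Env) :
    Env.subst g (Env.subst f Γ) = Env.subst (g ∘ f) Γ := by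
  simp [Env.subst, Key.subst_subst]

theorem Env.subst_id (Γ : Env) : Env.subst _root_.id Γ = Γ := by
  simp [Env.subst, Key.subst_id]

theorem Env.subst_args (f : Ident → Ident) (us : List Ident) (Ts : List Ty) :
    Env.subst f (Env.args us Ts) = Env.args (us.map f) Ts := by
  induction us generalizing Ts with
  | nil => rfl
  | cons u us ih =>
    cases Ts with
    | nil => rfl
    | cons T Ts =>
      have := ih Ts
      simp only [Env.args, Env.subst] at this ⊢
      simp only [List.map_cons, List.zip_cons_cons, ← Multiset.cons_coe, Multiset.map_cons, this]
      rfl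

theorem Env.mem_args {us : List Ident} {Ts : List Ty} {p : Key × Ty} (h : p ∈ Env.args us Ts) :
    ∃ u, p.1 = .id u := by
  obtain ⟨k, T⟩ := p
  have := (List.of_mem_zip (Multiset.mem_coe.1 h)).1
  obtain ⟨u, _, rfl⟩ := List.mem_map.1 this
  exact ⟨u, rfl⟩

theorem Env.subst_shiftP (f : Ident → Ident) (Γ : Env) :
    Env.subst f Γ.shiftP = (Env.subst f Γ).shiftP := by
  simp only [Env.subst, Env.shiftP, Multiset.map_map]
  refine Multiset.map_congr rfl fun p _ => ?_
  obtain ⟨k, T⟩ := p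
  cases k <;> rfl

theorem liftVar_comp_shiftVar (n : ℕ) (f : Ident → Ident) :
    liftVar n f ∘ shiftVar n = shiftVar n ∘ f := by
  funext u
  cases u <;> simp [liftVar, shiftVar]

theorem liftChan_comp_shiftChan (f : Ident → Ident) :
    liftChan f ∘ shiftChan = shiftChan ∘ f := by
  funext u
  cases u <;> simp [liftChan, shiftChan]

theorem map_liftVar_range (n : ℕ) (f : Ident → Ident) :
    ((List.range n).map Ident.var).map (liftVar n f) = (List.range n).map Ident.var := by
  rw [List.map_map]
  refine List.map_congr_left fun x hx => ?_
  simp [liftVar, List.mem_range.1 hx]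

theorem Uses.subst {Γ Δ : Env} {u : Ident} {Ts : List Ty} {a : Attr} (f : Ident → Ident)
    (h : Uses Γ u Ts a Δ) : Uses (Env.subst f Γ) (f u) Ts a (Env.subst f Δ) := by
  cases h with
  | aff => exact .aff
  | unr => rw [Env.subst_cons]; exact .unr
  | unq i => rw [Env.subst_cons]; exact .unq i

/-! ### Substitution of identifiers -/

/-- Injectivity is not needed: environments are multisets, so identifiers that become equal merely
give several assumptions for one key. Communication depends on this, since a received name may
already be known to the receiver. -/
theorem Typed.subst {Γ : Env} {P : Proc} (h : Typed Γ P) (f : Ident → Ident) :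
    Typed (Env.subst f Γ) (P.subst f) := by
  induction h generalizing f with
  | @inp Γ Δ u Ts a P hu _ ih =>
    rw [Env.subst_cons]
    refine .inp (hu.subst f) ?_
    have := ih (liftVar Ts.length f)
    rwa [Env.subst_add, Env.subst_args, map_liftVar_range, Env.subst_subst,
      liftVar_comp_shiftVar, ← Env.subst_subst] at this
  | out hl hu _ ih =>
    rw [Env.subst_cons, Env.subst_add, Env.subst_args]
    exact .out (by simpa using hl) (hu.subst f) (ih f)
  | par _ _ ih₁ ih₂ =>
    rw [Env.subst_add]
    exact .par (ih₁ f) (ih₂ f)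
  | ite hu hv _ _ ih₁ ih₂ =>
    obtain ⟨T, hT⟩ := hu
    obtain ⟨U, hU⟩ := hv
    exact .ite ⟨T, Multiset.mem_map.2 ⟨_, hT, rfl⟩⟩ ⟨U, Multiset.mem_map.2 ⟨_, hU, rfl⟩⟩
      (ih₁ f) (ih₂ f)
  | @recX Γ P hΓ _ ih =>
    refine .recX ?_ ?_
    · intro p hp
      obtain ⟨q, hq, rfl⟩ := Multiset.mem_map.1 hp
      exact hΓ q hq
    · have := ih f
      rwa [Env.subst_cons, Env.subst_shiftP] at this
  | pvar X => exact .pvar X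
  | alloc _ ih =>
    have := ih (liftVar 1 f)
    rw [Env.subst_cons, Env.subst_subst, liftVar_comp_shiftVar, ← Env.subst_subst] at this
    exact .alloc this
  | free _ ih =>
    rw [Env.subst_cons]
    exact .free (ih f)
  | nil => exact .nil
  | resTop _ ih =>
    have := ih (liftChan f)
    rw [Env.subst_cons, Env.subst_subst, liftChan_comp_shiftChan, ← Env.subst_subst] at this
    exact .resTop this
  | resBot _ ih =>
    refine .resBot ?_
    have := ih (liftChan f)
    rwa [Env.subst_subst, liftChan_comp_shiftChan, ← Env.subst_subst] at this
  | con hs _ ih =>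
    have := ih f
    rw [Env.subst_cons, Env.subst_cons] at this
    rw [Env.subst_cons]
    exact .con hs this
  | weak _ ih =>
    rw [Env.subst_cons]
    exact .weak (ih f)
  | sub _ hs ih =>
    have := ih f
    rw [Env.subst_cons] at this ⊢
    exact .sub this hs
  | rev _ ih =>
    have := ih f
    rw [Env.subst_cons] at this ⊢
    exact .rev this

theorem liftVar_comp (n : ℕ) (f g : Ident → Ident) :
    liftVar n g ∘ liftVar n f = liftVar n (g ∘ f) := by
  funext u
  cases u with
  | chan c =>
    simp only [liftVar, Function.comp]
    cases f (.chan c) <;> simp [shiftVar]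
  | var x =>
    by_cases hx : x < n
    · simp [liftVar, hx]
    · simp only [liftVar, Function.comp, hx, if_false]
      cases f (.var (x - n)) <;> simp [shiftVar]

theorem liftChan_comp (f g : Ident → Ident) :
    liftChan g ∘ liftChan f = liftChan (g ∘ f) := by
  funext u
  rcases u with (_ | c) | x
  · rfl
  · simp only [liftChan, Function.comp]
    cases f (.chan c) <;> simp [shiftChan]
  · simp only [liftChan, Function.comp]
    cases f (.var x) <;> simp [shiftChan]

theorem liftVar_id (n : ℕ) : liftVar n id = id := by
  funext u
  cases u with
  | chan c => rfl
  | var x =>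
    by_cases hx : x < n
    · simp [liftVar, hx]
    · simp only [liftVar, hx, if_false, shiftVar, id]
      congr 1
      omega

theorem liftChan_id : liftChan id = id := by
  funext u
  rcases u with (_ | c) | x <;> rfl

theorem Proc.subst_subst (f g : Ident → Ident) (P : Proc) :
    (P.subst f).subst g = P.subst (g ∘ f) := by
  induction P generalizing f g with
  | out u vs P ih => simp [Proc.subst, ih]
  | inp u n P ih => simp [Proc.subst, ih, liftVar_comp]
  | nil => rfl
  | ite u v P Q ih₁ ih₂ => simp [Proc.subst, ih₁, ih₂]
  | recX P ih => simp [Proc.subst, ih]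
  | pvar X => rfl
  | par P Q ih₁ ih₂ => simp [Proc.subst, ih₁, ih₂]
  | res s P ih => simp [Proc.subst, ih, liftChan_comp]
  | alloc P ih => simp [Proc.subst, ih, liftVar_comp]
  | free u P ih => simp [Proc.subst, ih]

theorem Proc.subst_id (P : Proc) : P.subst id = P := by
  induction P with
  | out u vs P ih => simp [Proc.subst, ih]
  | inp u n P ih => simp [Proc.subst, ih, liftVar_id]
  | nil => rfl
  | ite u v P Q ih₁ ih₂ => simp [Proc.subst, ih₁, ih₂]
  | recX P ih => simp [Proc.subst, ih]
  | pvar X => rfl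
  | par P Q ih₁ ih₂ => simp [Proc.subst, ih₁, ih₂]
  | res s P ih => simp [Proc.subst, ih, liftChan_id]
  | alloc P ih => simp [Proc.subst, ih, liftVar_id]
  | free u P ih => simp [Proc.subst, ih]

/-- The left inverse of `shiftChan` that sends the channel `0` to the channel `0`. -/
def unshiftChan : Ident → Ident
  | .chan c => .chan (c - 1)
  | .var x => .var x

theorem unshiftChan_comp_shiftChan : unshiftChan ∘ shiftChan = id := by
  funext u
  cases u <;> rfl

/-! ### Structural rules -/

/-- `Structural Γ Δ`: the structural rules lead from `Δ ⊢ P` to `Γ ⊢ P`. -/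
inductive Structural : Env → Env → Prop
  | refl (Γ : Env) : Structural Γ Γ
  | con {Γ Δ : Env} {k : Key} {T T₁ T₂ : Ty} :
      Split T T₁ T₂ → Structural ((k, T₁) ::ₘ (k, T₂) ::ₘ Γ) Δ → Structural ((k, T) ::ₘ Γ) Δ
  | weak {Γ Δ : Env} {k : Key} {T : Ty} : Structural Γ Δ → Structural ((k, T) ::ₘ Γ) Δ
  | sub {Γ Δ : Env} {k : Key} {T₁ T₂ : Ty} :
      Structural ((k, T₂) ::ₘ Γ) Δ → SubTy T₁ T₂ → Structural ((k, T₁) ::ₘ Γ) Δ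
  | rev {Γ Δ : Env} {k : Key} {Ts₁ Ts₂ : List Ty} :
      Structural ((k, .chan Ts₂ (.unq 0)) ::ₘ Γ) Δ → Structural ((k, .chan Ts₁ (.unq 0)) ::ₘ Γ) Δ

theorem Structural.typed {Γ Δ : Env} (h : Structural Γ Δ) {P : Proc} (hP : Typed Δ P) :
    Typed Γ P := by
  induction h with
  | refl => exact hP
  | con hs _ ih => exact .con hs (ih hP)
  | weak _ ih => exact .weak (ih hP)
  | sub _ hs ih => exact .sub (ih hP) hs
  | rev _ ih => exact .rev (ih hP)

theorem Structural.trans {Γ Δ Θ : Env} (h : Structural Γ Δ) (h' : Structural Δ Θ) :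
    Structural Γ Θ := by
  induction h with
  | refl => exact h'
  | con hs _ ih => exact .con hs (ih h')
  | weak _ ih => exact .weak (ih h')
  | sub _ hs ih => exact .sub (ih h') hs
  | rev _ ih => exact .rev (ih h')

theorem Structural.add_right {Γ Δ : Env} (h : Structural Γ Δ) (Θ : Env) :
    Structural (Γ + Θ) (Δ + Θ) := by
  induction h with
  | refl => exact .refl _
  | con hs _ ih => simp only [Multiset.cons_add] at ih ⊢; exact .con hs ih
  | weak _ ih => simp only [Multiset.cons_add] at ih ⊢; exact .weak ih
  | sub _ hs ih => simp only [Multiset.cons_add] at ih ⊢; exact .sub ih hs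
  | rev _ ih => simp only [Multiset.cons_add] at ih ⊢; exact .rev ih

theorem Structural.add_left {Γ Δ : Env} (h : Structural Γ Δ) (Θ : Env) :
    Structural (Θ + Γ) (Θ + Δ) := by
  rw [add_comm Θ, add_comm Θ]
  exact h.add_right Θ

theorem Structural.add {Γ Δ Γ' Δ' : Env} (h : Structural Γ Δ) (h' : Structural Γ' Δ') :
    Structural (Γ + Γ') (Δ + Δ') :=
  (h.add_right _).trans (h'.add_left _)

theorem Structural.cons {Γ Δ : Env} (h : Structural Γ Δ) (p : Key × Ty) :
    Structural (p ::ₘ Γ) (p ::ₘ Δ) := by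
  rw [← Multiset.singleton_add, ← Multiset.singleton_add]
  exact h.add_left _

theorem Structural.subst {Γ Δ : Env} (h : Structural Γ Δ) (f : Ident → Ident) :
    Structural (Env.subst f Γ) (Env.subst f Δ) := by
  induction h with
  | refl => exact .refl _
  | con hs _ ih => simp only [Env.subst_cons] at ih ⊢; exact .con hs ih
  | weak _ ih => simp only [Env.subst_cons] at ih ⊢; exact .weak ih
  | sub _ hs ih => simp only [Env.subst_cons] at ih ⊢; exact .sub ih hs
  | rev _ ih => simp only [Env.subst_cons] at ih ⊢; exact .rev ih

theorem Structural.add_weak (Γ Δ : Env) : Structural (Γ + Δ) Δ := by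
  induction Γ using Multiset.induction with
  | empty => rw [zero_add]; exact .refl _
  | cons p Γ ih => rw [Multiset.cons_add]; exact .weak ih

theorem Structural.of_le {Γ Δ : Env} (h : Δ ≤ Γ) : Structural Γ Δ := by
  obtain ⟨Θ, rfl⟩ := Multiset.le_iff_exists_add.1 h
  rw [add_comm]
  exact .add_weak _ _

/-- Each structural rule acts on a single key: if the key is kept the rule survives, otherwise it
becomes void. -/
theorem Structural.filter {Γ Δ : Env} (h : Structural Γ Δ) (p : Key → Prop) [DecidablePred p] :
    Structural (Multiset.filter (fun q => p q.1) Γ) (Multiset.filter (fun q => p q.1) Δ) := by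
  induction h with
  | refl => exact .refl _
  | @con Γ Δ k T T₁ T₂ hs _ ih =>
    by_cases hk : p k
    · simp only [Multiset.filter_cons, hk, if_true, Multiset.singleton_add] at ih ⊢
      exact .con hs ih
    · simpa only [Multiset.filter_cons, hk, if_false, zero_add] using ih
  | @weak Γ Δ k T _ ih =>
    by_cases hk : p k
    · simp only [Multiset.filter_cons, hk, if_true, Multiset.singleton_add] at ih ⊢
      exact .weak ih
    · simpa only [Multiset.filter_cons, hk, if_false, zero_add] using ih
  | @sub Γ Δ k T₁ T₂ _ hs ih =>
    by_cases hk : p k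
    · simp only [Multiset.filter_cons, hk, if_true, Multiset.singleton_add] at ih ⊢
      exact .sub ih hs
    · simpa only [Multiset.filter_cons, hk, if_false, zero_add] using ih
  | @rev Γ Δ k Ts₁ Ts₂ _ ih =>
    by_cases hk : p k
    · simp only [Multiset.filter_cons, hk, if_true, Multiset.singleton_add] at ih ⊢
      exact .rev ih
    · simpa only [Multiset.filter_cons, hk, if_false, zero_add] using ih

theorem Structural.exists_mem {Γ Δ : Env} (h : Structural Γ Δ) {k : Key}
    (hk : ∃ T, (k, T) ∈ Δ) : ∃ T, (k, T) ∈ Γ := by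
  induction h with
  | refl => exact hk
  | con _ _ ih =>
    obtain ⟨T, hT⟩ := ih hk
    simp only [Multiset.mem_cons, Prod.mk.injEq] at hT ⊢
    rcases hT with ⟨rfl, _⟩ | ⟨rfl, _⟩ | hT
    · exact ⟨_, .inl ⟨rfl, rfl⟩⟩
    · exact ⟨_, .inl ⟨rfl, rfl⟩⟩
    · exact ⟨_, .inr hT⟩
  | weak _ ih =>
    obtain ⟨T, hT⟩ := ih hk
    exact ⟨T, Multiset.mem_cons_of_mem hT⟩
  | sub _ _ ih =>
    obtain ⟨T, hT⟩ := ih hk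
    simp only [Multiset.mem_cons, Prod.mk.injEq] at hT ⊢
    rcases hT with ⟨rfl, _⟩ | hT
    · exact ⟨_, .inl ⟨rfl, rfl⟩⟩
    · exact ⟨_, .inr hT⟩
  | rev _ ih =>
    obtain ⟨T, hT⟩ := ih hk
    simp only [Multiset.mem_cons, Prod.mk.injEq] at hT ⊢
    rcases hT with ⟨rfl, _⟩ | hT
    · exact ⟨_, .inl ⟨rfl, rfl⟩⟩
    · exact ⟨_, .inr hT⟩

theorem Structural.contract {Γ : Env} (h : ∀ p ∈ Γ, p.2.Unrestricted) : Structural Γ (Γ + Γ) := by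
  induction Γ using Multiset.induction with
  | empty => exact .refl _
  | cons p Γ ih =>
    obtain ⟨k, T⟩ := p
    have hT : Split T T T := by
      have := h (k, T) (Multiset.mem_cons_self _ _)
      cases this with
      | chan Ts => exact .unr Ts
      | proc => exact .proc
    refine .con hT ?_
    rw [Multiset.cons_add, Multiset.add_cons]
    exact ((ih fun p hp => h p (Multiset.mem_cons_of_mem hp)).cons _).cons _

/-! ### Inversion of the typing relation -/

/-- `P` is typed in `Γ` by the logical rule for its outermost constructor. -/
def Logical (Γ : Env) : Proc → Prop
  | .out u vs P => ∃ Γ' Δ Ts a, vs.length = Ts.length ∧ Uses Γ' u Ts a Δ ∧ Typed Δ P ∧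
      Γ = (.id u, .chan Ts a) ::ₘ (Γ' + Env.args vs Ts)
  | .inp u n P => ∃ Γ' Δ Ts a, n = Ts.length ∧ Uses Γ' u Ts a Δ ∧
      Typed (Env.subst (shiftVar Ts.length) Δ
        + Env.args ((List.range Ts.length).map Ident.var) Ts) P ∧
      Γ = (.id u, .chan Ts a) ::ₘ Γ'
  | .nil => Γ = 0
  | .ite u v P Q => (∃ T, (Key.id u, T) ∈ Γ) ∧ (∃ T, (Key.id v, T) ∈ Γ) ∧ Typed Γ P ∧ Typed Γ Q
  | .recX P => (∀ p ∈ Γ, p.2.Unrestricted) ∧ Typed ((.pvar 0, .proc) ::ₘ Γ.shiftP) P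
  | .pvar X => Γ = {(.pvar X, .proc)}
  | .par P Q => ∃ Γ₁ Γ₂, Typed Γ₁ P ∧ Typed Γ₂ Q ∧ Γ = Γ₁ + Γ₂
  | .res .top P => ∃ T, Typed ((.id (.chan 0), T) ::ₘ Γ.subst shiftChan) P
  | .res .bot P => Typed (Γ.subst shiftChan) P
  | .alloc P => ∃ Ts, Typed ((.id (.var 0), .chan Ts (.unq 0)) ::ₘ Γ.subst (shiftVar 1)) P
  | .free u P => ∃ Γ' Ts, Typed Γ' P ∧ Γ = (.id u, .chan Ts (.unq 0)) ::ₘ Γ'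

/-- Structural rules leave the process unchanged, so those at the end of the derivation accumulate
until a logical rule is reached. -/
theorem Typed.inversion {Γ : Env} {P : Proc} (h : Typed Γ P) :
    ∃ Δ, Structural Γ Δ ∧ Logical Δ P := by
  induction h with
  | inp hu hP => exact ⟨_, .refl _, _, _, _, _, rfl, hu, hP, rfl⟩
  | out hl hu hP => exact ⟨_, .refl _, _, _, _, _, hl, hu, hP, rfl⟩
  | par hP hQ => exact ⟨_, .refl _, _, _, hP, hQ, rfl⟩
  | ite hu hv hP hQ => exact ⟨_, .refl _, hu, hv, hP, hQ⟩
  | recX hΓ hP => exact ⟨_, .refl _, hΓ, hP⟩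
  | pvar X => exact ⟨_, .refl _, rfl⟩
  | alloc hP => exact ⟨_, .refl _, _, hP⟩
  | free hP => exact ⟨_, .refl _, _, _, hP, rfl⟩
  | nil => exact ⟨_, .refl _, rfl⟩
  | resTop hP => exact ⟨_, .refl _, _, hP⟩
  | resBot hP => exact ⟨_, .refl _, hP⟩
  | con hs _ ih => obtain ⟨Δ, h, hl⟩ := ih; exact ⟨Δ, .con hs h, hl⟩
  | weak _ ih => obtain ⟨Δ, h, hl⟩ := ih; exact ⟨Δ, .weak h, hl⟩
  | sub _ hs ih => obtain ⟨Δ, h, hl⟩ := ih; exact ⟨Δ, .sub h hs, hl⟩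
  | rev _ ih => obtain ⟨Δ, h, hl⟩ := ih; exact ⟨Δ, .rev h, hl⟩

theorem Typed.par_inv {Γ : Env} {P Q : Proc} (h : Typed Γ (.par P Q)) :
    ∃ Γ₁ Γ₂, Structural Γ (Γ₁ + Γ₂) ∧ Typed Γ₁ P ∧ Typed Γ₂ Q := by
  obtain ⟨Δ, hs, Γ₁, Γ₂, hP, hQ, rfl⟩ := h.inversion
  exact ⟨_, _, hs, hP, hQ⟩

/-- No structural residue remains: the premise of the scoping rule contains the whole environment,
shifted, so the residue can be replayed above the rule. -/
theorem Typed.resTop_inv {Γ : Env} {P : Proc} (h : Typed Γ (.res .top P)) :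
    ∃ T, Typed ((.id (.chan 0), T) ::ₘ Γ.subst shiftChan) P := by
  obtain ⟨Δ, hs, T, hP⟩ := h.inversion
  exact ⟨T, ((hs.subst _).cons _).typed hP⟩

theorem Typed.resBot_inv {Γ : Env} {P : Proc} (h : Typed Γ (.res .bot P)) :
    Typed (Γ.subst shiftChan) P := by
  obtain ⟨Δ, hs, hP⟩ := h.inversion
  exact (hs.subst _).typed hP

theorem Typed.alloc_inv {Γ : Env} {P : Proc} (h : Typed Γ (.alloc P)) :
    ∃ Ts, Typed ((.id (.var 0), .chan Ts (.unq 0)) ::ₘ Γ.subst (shiftVar 1)) P := by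
  obtain ⟨Δ, hs, T, hP⟩ := h.inversion
  exact ⟨T, ((hs.subst _).cons _).typed hP⟩

theorem Typed.ite_inv {Γ : Env} {u v : Ident} {P Q : Proc} (h : Typed Γ (.ite u v P Q)) :
    (∃ T, (Key.id u, T) ∈ Γ) ∧ (∃ T, (Key.id v, T) ∈ Γ) ∧ Typed Γ P ∧ Typed Γ Q := by
  obtain ⟨Δ, hs, hu, hv, hP, hQ⟩ := h.inversion
  exact ⟨hs.exists_mem hu, hs.exists_mem hv, hs.typed hP, hs.typed hQ⟩

theorem Typed.weaken {Γ Δ : Env} {P : Proc} (hP : Typed Δ P) : Typed (Δ + Γ) P := by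
  rw [add_comm]
  exact (Structural.add_weak Γ Δ).typed hP

/-! ### Substitution of processes -/

def Key.ren (r : ℕ → ℕ) : Key → Key
  | .id u => .id u
  | .pvar X => .pvar (r X)

/-- Renaming of the process variables of an environment. -/
def Env.ren (r : ℕ → ℕ) (Γ : Env) : Env :=
  Γ.map fun p => (p.1.ren r, p.2)

theorem Env.ren_cons (r : ℕ → ℕ) (k : Key) (T : Ty) (Γ : Env) :
    Env.ren r ((k, T) ::ₘ Γ) = (k.ren r, T) ::ₘ Env.ren r Γ := by
  simp [Env.ren]

theorem Env.ren_add (r : ℕ → ℕ) (Γ Δ : Env) : Env.ren r (Γ + Δ) = Env.ren r Γ + Env.ren r Δ := by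
  simp [Env.ren]

theorem Env.ren_subst (r : ℕ → ℕ) (f : Ident → Ident) (Γ : Env) :
    Env.ren r (Env.subst f Γ) = Env.subst f (Env.ren r Γ) := by
  simp only [Env.subst, Env.ren, Multiset.map_map]
  refine Multiset.map_congr rfl fun p _ => ?_
  obtain ⟨k, T⟩ := p
  cases k <;> rfl

theorem Env.ren_args (r : ℕ → ℕ) (us : List Ident) (Ts : List Ty) :
    Env.ren r (Env.args us Ts) = Env.args us Ts := by
  rw [Env.ren]
  conv_rhs => rw [← Multiset.map_id (Env.args us Ts)]
  refine Multiset.map_congr rfl fun p hp => ?_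
  obtain ⟨k, T⟩ := p
  obtain ⟨u, rfl⟩ := Env.mem_args hp
  rfl

theorem Env.shiftP_eq_ren : Env.shiftP = Env.ren Nat.succ := by
  funext Γ
  refine Multiset.map_congr rfl fun p _ => ?_
  obtain ⟨k, T⟩ := p
  cases k <;> rfl

theorem Env.ren_shiftP (r : ℕ → ℕ) (Γ : Env) :
    Env.ren (liftRen r) Γ.shiftP = (Env.ren r Γ).shiftP := by
  simp only [Env.shiftP, Env.ren, Multiset.map_map]
  refine Multiset.map_congr rfl fun p _ => ?_
  obtain ⟨k, T⟩ := p
  cases k <;> rfl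

theorem Uses.ren {Γ Δ : Env} {u : Ident} {Ts : List Ty} {a : Attr} (r : ℕ → ℕ)
    (h : Uses Γ u Ts a Δ) : Uses (Env.ren r Γ) u Ts a (Env.ren r Δ) := by
  cases h with
  | aff => exact .aff
  | unr => rw [Env.ren_cons]; exact .unr
  | unq i => rw [Env.ren_cons]; exact .unq i

theorem Typed.renP {Γ : Env} {P : Proc} (h : Typed Γ P) (r : ℕ → ℕ) :
    Typed (Env.ren r Γ) (P.renP r) := by
  induction h generalizing r with
  | inp hu _ ih =>
    rw [Env.ren_cons]
    refine .inp (hu.ren r) ?_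
    have := ih r
    rwa [Env.ren_add, Env.ren_args, Env.ren_subst] at this
  | out hl hu _ ih =>
    rw [Env.ren_cons, Env.ren_add, Env.ren_args]
    exact .out hl (hu.ren r) (ih r)
  | par _ _ ih₁ ih₂ =>
    rw [Env.ren_add]
    exact .par (ih₁ r) (ih₂ r)
  | ite hu hv _ _ ih₁ ih₂ =>
    obtain ⟨T, hT⟩ := hu
    obtain ⟨U, hU⟩ := hv
    exact .ite ⟨T, Multiset.mem_map.2 ⟨_, hT, rfl⟩⟩ ⟨U, Multiset.mem_map.2 ⟨_, hU, rfl⟩⟩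
      (ih₁ r) (ih₂ r)
  | recX hΓ _ ih =>
    refine .recX ?_ ?_
    · intro p hp
      obtain ⟨q, hq, rfl⟩ := Multiset.mem_map.1 hp
      exact hΓ q hq
    · have := ih (liftRen r)
      rwa [Env.ren_cons, Env.ren_shiftP] at this
  | pvar X => exact .pvar (r X)
  | alloc _ ih =>
    have := ih r
    rw [Env.ren_cons, Env.ren_subst] at this
    exact .alloc this
  | free _ ih =>
    rw [Env.ren_cons]
    exact .free (ih r)
  | nil => exact .nil
  | resTop _ ih =>
    have := ih r
    rw [Env.ren_cons, Env.ren_subst] at this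
    exact .resTop this
  | resBot _ ih =>
    have := ih r
    rw [Env.ren_subst] at this
    exact .resBot this
  | con hs _ ih =>
    have := ih r
    rw [Env.ren_cons, Env.ren_cons] at this
    rw [Env.ren_cons]
    exact .con hs this
  | weak _ ih =>
    rw [Env.ren_cons]
    exact .weak (ih r)
  | sub _ hs ih =>
    have := ih r
    rw [Env.ren_cons] at this ⊢
    exact .sub this hs
  | rev _ ih =>
    have := ih r
    rw [Env.ren_cons] at this ⊢
    exact .rev this

/-- Replacement of one assumption: `X : proc` by the environment `E X`; an assumption that gives a
process variable a channel type cannot be used and is dropped. -/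
def Key.substP (E : ℕ → Env) : Key × Ty → Env
  | (.id u, T) => {(.id u, T)}
  | (.pvar X, .proc) => E X
  | (.pvar _, .chan _ _) => 0

/-- Replacement of the assumptions `X : proc` by the environments `E X`. -/
def Env.substP (E : ℕ → Env) (Γ : Env) : Env :=
  Γ.bind (Key.substP E)

theorem Env.substP_cons (E : ℕ → Env) (p : Key × Ty) (Γ : Env) :
    Env.substP E (p ::ₘ Γ) = Key.substP E p + Env.substP E Γ := by
  simp [Env.substP]

theorem Env.substP_cons_id (E : ℕ → Env) (u : Ident) (T : Ty) (Γ : Env) :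
    Env.substP E ((.id u, T) ::ₘ Γ) = (.id u, T) ::ₘ Env.substP E Γ := by
  simp [Env.substP_cons, Key.substP]

theorem Env.substP_add (E : ℕ → Env) (Γ Δ : Env) :
    Env.substP E (Γ + Δ) = Env.substP E Γ + Env.substP E Δ := by
  simp [Env.substP]

theorem Env.substP_subst (E : ℕ → Env) (f : Ident → Ident) (Γ : Env) :
    Env.substP (fun X => Env.subst f (E X)) (Env.subst f Γ) = Env.subst f (Env.substP E Γ) := by
  induction Γ using Multiset.induction with
  | empty => rfl
  | cons p Γ ih =>
    obtain ⟨k, T⟩ := p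
    rw [Env.subst_cons, Env.substP_cons, Env.substP_cons, Env.subst_add, ih]
    rcases k with u | X <;> rcases T <;> rfl

theorem Env.substP_args (E : ℕ → Env) (us : List Ident) (Ts : List Ty) :
    Env.substP E (Env.args us Ts) = Env.args us Ts := by
  have : ∀ Γ : Env, (∀ p ∈ Γ, ∃ u, p.1 = .id u) → Env.substP E Γ = Γ := by
    intro Γ h
    induction Γ using Multiset.induction with
    | empty => rfl
    | cons p Γ ih =>
      obtain ⟨k, T⟩ := p
      obtain ⟨u, rfl⟩ := h _ (Multiset.mem_cons_self _ _)
      rw [Env.substP_cons_id, ih fun q hq => h q (Multiset.mem_cons_of_mem hq)]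
  exact this _ fun p hp => Env.mem_args hp

/-- Carry a family of environments under a binder of one process variable. -/
def liftEnv (E : ℕ → Env) : ℕ → Env
  | 0 => {(.pvar 0, .proc)}
  | X + 1 => (E X).shiftP

theorem Env.substP_shiftP (E : ℕ → Env) (Γ : Env) :
    Env.substP (liftEnv E) Γ.shiftP = (Env.substP E Γ).shiftP := by
  induction Γ using Multiset.induction with
  | empty => rfl
  | cons p Γ ih =>
    obtain ⟨k, T⟩ := p
    rw [Env.substP_cons, Env.shiftP, Env.shiftP, Multiset.map_cons, Env.substP_cons,
      Multiset.map_add]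
    refine congrArg₂ _ ?_ ih
    rcases k with u | X <;> rcases T <;> rfl

theorem Uses.substP {Γ Δ : Env} {u : Ident} {Ts : List Ty} {a : Attr} (E : ℕ → Env)
    (h : Uses Γ u Ts a Δ) : Uses (Env.substP E Γ) u Ts a (Env.substP E Δ) := by
  cases h with
  | aff => exact .aff
  | unr => rw [Env.substP_cons_id]; exact .unr
  | unq i => rw [Env.substP_cons_id]; exact .unq i

theorem Env.mem_substP {E : ℕ → Env} {Γ : Env} {u : Ident} (h : ∃ T, (Key.id u, T) ∈ Γ) :
    ∃ T, (Key.id u, T) ∈ Env.substP E Γ := by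
  obtain ⟨T, hT⟩ := h
  exact ⟨T, Multiset.mem_bind.2 ⟨_, hT, Multiset.mem_singleton_self _⟩⟩

theorem unrestricted_subst {Γ : Env} (f : Ident → Ident) (h : ∀ p ∈ Γ, p.2.Unrestricted) :
    ∀ p ∈ Env.subst f Γ, p.2.Unrestricted := by
  intro p hp
  obtain ⟨q, hq, rfl⟩ := Multiset.mem_map.1 hp
  exact h q hq

/-- Splitting `X : proc` duplicates `E X`, hence the restriction to unrestricted assumptions. Rules
on a process variable with a channel type become trivial, as such assumptions are dropped. -/
theorem Structural.substP {E : ℕ → Env} (hE : ∀ X, ∀ p ∈ E X, p.2.Unrestricted) {Γ Δ : Env}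
    (h : Structural Γ Δ) : Structural (Env.substP E Γ) (Env.substP E Δ) := by
  induction h with
  | refl => exact .refl _
  | @con Γ Δ k T T₁ T₂ hs _ ih =>
    refine .trans ?_ ih
    simp only [Env.substP_cons, ← add_assoc]
    refine .add_right ?_ _
    cases k with
    | id u => exact .con (Γ := 0) (k := .id u) hs (.refl _)
    | pvar X =>
      cases hs with
      | unr => exact .refl _
      | proc => exact .contract (hE X)
      | unq => exact .refl _
  | weak _ ih =>
    rw [Env.substP_cons]
    exact .trans (.add_weak _ _) ih
  | @sub Γ Δ k T₁ T₂ _ hs ih =>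
    refine .trans ?_ ih
    rw [Env.substP_cons, Env.substP_cons]
    refine .add_right ?_ _
    cases k with
    | id u => exact .sub (Γ := 0) (k := .id u) (.refl _) hs
    | pvar X => cases hs; exact .refl _
  | @rev Γ Δ k Ts₁ Ts₂ _ ih =>
    refine .trans ?_ ih
    rw [Env.substP_cons, Env.substP_cons]
    refine .add_right ?_ _
    cases k with
    | id u => exact .rev (Γ := 0) (k := .id u) (.refl _)
    | pvar X => exact .refl _

/-- The substitution is simultaneous, with one environment per process variable, so that it passes
under every binder: the family is shifted there, or extended by the identity at a new process
variable. -/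
theorem Typed.substP {Γ : Env} {P : Proc} (h : Typed Γ P) {t : ℕ → Proc} {E : ℕ → Env}
    (hE : ∀ X, ∀ p ∈ E X, p.2.Unrestricted) (ht : ∀ X, Typed (E X) (t X)) :
    Typed (Env.substP E Γ) (P.substP t) := by
  induction h generalizing t E with
  | @inp Γ Δ u Ts a P hu _ ih =>
    rw [Env.substP_cons_id]
    refine .inp (hu.substP E) ?_
    have := ih (fun X => unrestricted_subst (shiftVar Ts.length) (hE X))
      fun X => (ht X).subst (shiftVar Ts.length)
    rwa [Env.substP_add, Env.substP_args, Env.substP_subst] at this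
  | out hl hu _ ih =>
    rw [Env.substP_cons_id, Env.substP_add, Env.substP_args]
    exact .out hl (hu.substP E) (ih hE ht)
  | par _ _ ih₁ ih₂ =>
    rw [Env.substP_add]
    exact .par (ih₁ hE ht) (ih₂ hE ht)
  | ite hu hv _ _ ih₁ ih₂ =>
    exact .ite (Env.mem_substP hu) (Env.mem_substP hv) (ih₁ hE ht) (ih₂ hE ht)
  | @recX Γ P hΓ _ ih =>
    refine .recX ?_ ?_
    · intro p hp
      obtain ⟨⟨k, T⟩, hq, hp⟩ := Multiset.mem_bind.1 hp
      rcases k with u | X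
      · rw [Multiset.mem_singleton.1 hp]
        exact hΓ _ hq
      · rcases T with ⟨Ts, a⟩ | _
        · exact absurd hp (Multiset.notMem_zero _)
        · exact hE X p hp
    · have := ih (t := liftProc t) (E := liftEnv E) ?_ ?_
      · rw [Env.substP_cons, Env.substP_shiftP] at this
        simpa only [Key.substP, liftEnv, Multiset.singleton_add] using this
      · rintro (_ | X) p hp
        · rw [Multiset.mem_singleton.1 hp]
          exact .proc
        · obtain ⟨q, hq, rfl⟩ := Multiset.mem_map.1 hp
          exact hE X q hq
      · rintro (_ | X)
        · exact .pvar 0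
        · have := (ht X).renP Nat.succ
          rwa [← Env.shiftP_eq_ren] at this
  | pvar X => simpa [Env.substP, Key.substP, Proc.substP] using ht X
  | alloc _ ih =>
    have := ih (fun X => unrestricted_subst (shiftVar 1) (hE X)) fun X => (ht X).subst (shiftVar 1)
    rw [Env.substP_cons_id, Env.substP_subst] at this
    exact .alloc this
  | free _ ih =>
    rw [Env.substP_cons_id]
    exact .free (ih hE ht)
  | nil => exact .nil
  | resTop _ ih =>
    have := ih (fun X => unrestricted_subst shiftChan (hE X)) fun X => (ht X).subst shiftChan
    rw [Env.substP_cons_id, Env.substP_subst] at this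
    exact .resTop this
  | resBot _ ih =>
    have := ih (fun X => unrestricted_subst shiftChan (hE X)) fun X => (ht X).subst shiftChan
    rw [Env.substP_subst] at this
    exact .resBot this
  | con hs _ ih => exact ((Structural.con hs (.refl _)).substP hE).typed (ih hE ht)
  | weak _ ih => exact ((Structural.weak (.refl _)).substP hE).typed (ih hE ht)
  | sub _ hs ih => exact ((Structural.sub (.refl _) hs).substP hE).typed (ih hE ht)
  | rev _ ih => exact ((Structural.rev (.refl _)).substP hE).typed (ih hE ht)

theorem Typed.unfold {Γ : Env} {P : Proc} (h : Typed Γ (.recX P)) :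
    Typed Γ (P.substP (instProc (.recX P))) := by
  obtain ⟨Δ, hs, hΔ, hP⟩ := h.inversion
  refine hs.typed ?_
  -- The unfolded variable is paid for with `Δ`, the environment of the recursion itself; every
  -- other process variable pays for itself.
  let E : ℕ → Env := fun X => Nat.casesOn X Δ fun X => {(.pvar X, .proc)}
  have hE : ∀ X, ∀ p ∈ E X, p.2.Unrestricted := by
    rintro (_ | X) p hp
    · exact hΔ p hp
    · rw [Multiset.mem_singleton.1 hp]
      exact .proc
  have ht : ∀ X, Typed (E X) (instProc (.recX P) X) := by
    rintro (_ | X)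
    · exact .recX hΔ hP
    · exact .pvar X
  -- Only an inequality: process variables with a channel type disappear.
  have hsub : ∀ Γ : Env, Env.substP E Γ.shiftP ≤ Γ := by
    intro Γ
    induction Γ using Multiset.induction with
    | empty => exact le_rfl
    | cons p Γ ih =>
      obtain ⟨k, T⟩ := p
      rw [Env.shiftP, Multiset.map_cons, Env.substP_cons, ← Multiset.singleton_add]
      refine add_le_add ?_ ih
      rcases k with u | X <;> rcases T <;> simp [Key.substP, Key.shiftP, E]
  have := hP.substP hE ht
  rw [Env.substP_cons] at this
  -- One copy of `Δ` types the recursive occurrences, the other the body; both come from a single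
  -- `Δ` by contraction.
  exact (Structural.contract hΔ).typed (((Structural.of_le (hsub Δ)).add_left Δ).typed this)

/-! ### Free names -/

theorem names_liftVar {n c : ℕ} {f : Ident → Ident} (h : ∃ u, c ∈ (liftVar n f u).names) :
    ∃ u, c ∈ (f u).names := by
  obtain ⟨u, hu⟩ := h
  have hs : ∀ v, (shiftVar n v).names = v.names := by rintro (_ | _) <;> rfl
  rcases u with d | x
  · exact ⟨.chan d, by rwa [liftVar, hs] at hu⟩
  · by_cases hx : x < n
    · simp [liftVar, hx, Ident.names] at hu
    · exact ⟨.var (x - n), by rwa [liftVar, if_neg hx, hs] at hu⟩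

theorem names_shiftChan {c : ℕ} {u : Ident} (h : c + 1 ∈ (shiftChan u).names) : c ∈ u.names := by
  rcases u with d | x
  · exact Nat.succ_injective h
  · exact h

theorem names_liftChan {c : ℕ} {f : Ident → Ident} (h : ∃ u, c + 1 ∈ (liftChan f u).names) :
    ∃ u, c ∈ (f u).names := by
  rcases h with ⟨(_ | d) | x, hu⟩
  · exact absurd hu (Nat.succ_ne_zero c)
  · exact ⟨_, names_shiftChan hu⟩
  · exact ⟨_, names_shiftChan hu⟩

/-- A coarse bound, since `u` need not occur in `P`. It suffices for shifted processes: no value of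
`shiftChan` has the name `0`. -/
theorem Proc.fn_subst {f : Ident → Ident} {P : Proc} {c : ℕ} (h : c ∈ (P.subst f).fn) :
    ∃ u, c ∈ (f u).names := by
  induction P generalizing f c with
  | out u vs P ih =>
    rcases h with (h | ⟨v, hv, h⟩) | h
    · exact ⟨u, h⟩
    · obtain ⟨w, _, rfl⟩ := List.mem_map.1 hv
      exact ⟨w, h⟩
    · exact ih h
  | inp u n P ih =>
    rcases h with h | h
    · exact ⟨u, h⟩
    · exact names_liftVar (ih h)
  | nil => exact absurd h (Set.notMem_empty _)
  | ite u v P Q ih₁ ih₂ =>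
    rcases h with ((h | h) | h) | h
    · exact ⟨u, h⟩
    · exact ⟨v, h⟩
    · exact ih₁ h
    · exact ih₂ h
  | recX P ih => exact ih h
  | pvar X => exact absurd h (Set.notMem_empty _)
  | par P Q ih₁ ih₂ =>
    rcases h with h | h
    · exact ih₁ h
    · exact ih₂ h
  | res s P ih => exact names_liftChan (ih h)
  | alloc P ih => exact names_liftVar (ih h)
  | free u P ih =>
    rcases h with h | h
    · exact ⟨u, h⟩
    · exact ih h

theorem Env.exists_mem_of_subst_shiftChan {Γ : Env} {c : ℕ}
    (h : ∃ T, (Key.id (.chan c), T) ∈ Env.subst shiftChan Γ) :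
    ∃ d, c = d + 1 ∧ ∃ T, (Key.id (.chan d), T) ∈ Γ := by
  obtain ⟨T, hT⟩ := h
  obtain ⟨⟨k, U⟩, hp, he⟩ := Multiset.mem_map.1 hT
  rcases k with (d | x) | X
  · simp only [Key.subst, shiftChan, Prod.mk.injEq, Key.id.injEq, Ident.chan.injEq] at he
    exact ⟨d, he.1.symm, U, hp⟩
  · simp [Key.subst, shiftChan] at he
  · simp [Key.subst] at he

theorem Env.exists_mem_of_subst_shiftVar {Γ : Env} {n c : ℕ}
    (h : ∃ T, (Key.id (.chan c), T) ∈ Env.subst (shiftVar n) Γ) :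
    ∃ T, (Key.id (.chan c), T) ∈ Γ := by
  obtain ⟨T, hT⟩ := h
  obtain ⟨⟨k, U⟩, hp, he⟩ := Multiset.mem_map.1 hT
  rcases k with (d | x) | X
  · simp only [Key.subst, shiftVar, Prod.mk.injEq, Key.id.injEq, Ident.chan.injEq] at he
    exact ⟨U, he.1 ▸ hp⟩
  · simp [Key.subst, shiftVar] at he
  · simp [Key.subst] at he

theorem Env.exists_mem_of_shiftP {Γ : Env} {u : Ident}
    (h : ∃ T, (Key.id u, T) ∈ Env.shiftP Γ) : ∃ T, (Key.id u, T) ∈ Γ := by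
  obtain ⟨T, hT⟩ := h
  obtain ⟨⟨k, U⟩, hp, he⟩ := Multiset.mem_map.1 hT
  rcases k with v | X
  · simp only [Key.shiftP, Prod.mk.injEq, Key.id.injEq] at he
    exact ⟨U, he.1 ▸ hp⟩
  · simp [Key.shiftP] at he

theorem Env.exists_mem_cons_of_ne {Γ : Env} {k k' : Key} {T : Ty} (hk : k ≠ k')
    (h : ∃ U, (k, U) ∈ (k', T) ::ₘ Γ) : ∃ U, (k, U) ∈ Γ := by
  obtain ⟨U, hU⟩ := h
  rcases Multiset.mem_cons.1 hU with h | h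
  · exact absurd (congrArg Prod.fst h) hk
  · exact ⟨U, h⟩

theorem Env.exists_mem_args {us : List Ident} {Ts : List Ty} (hl : us.length = Ts.length)
    {u : Ident} (hu : u ∈ us) : ∃ T, (Key.id u, T) ∈ Env.args us Ts := by
  induction us generalizing Ts with
  | nil => simp at hu
  | cons v us ih =>
    cases Ts with
    | nil => simp at hl
    | cons T Ts =>
      rcases List.mem_cons.1 hu with rfl | hu
      · exact ⟨T, by simp [Env.args]⟩
      · obtain ⟨U, hU⟩ := ih (Nat.succ_injective hl) hu
        exact ⟨U, Multiset.mem_cons_of_mem hU⟩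

theorem Env.exists_mem_add {Γ Δ : Env} {k : Key} :
    (∃ T, (k, T) ∈ Γ + Δ) ↔ (∃ T, (k, T) ∈ Γ) ∨ ∃ T, (k, T) ∈ Δ := by
  simp only [Multiset.mem_add, exists_or]

theorem Uses.exists_mem {Γ Δ : Env} {u : Ident} {Ts : List Ty} {a : Attr} (h : Uses Γ u Ts a Δ)
    {k : Key} (hk : ∃ T, (k, T) ∈ Δ) : ∃ T, (k, T) ∈ (.id u, .chan Ts a) ::ₘ Γ := by
  obtain ⟨T, hT⟩ := hk
  cases h with
  | aff => exact ⟨T, Multiset.mem_cons_of_mem hT⟩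
  | unr => exact ⟨T, hT⟩
  | unq i =>
    rcases Multiset.mem_cons.1 hT with h | h
    · cases h
      exact ⟨_, Multiset.mem_cons_self _ _⟩
    · exact ⟨T, Multiset.mem_cons_of_mem h⟩

theorem exists_mem_of_names {Γ : Env} {u : Ident} {c : ℕ} (h : ∃ T, (Key.id u, T) ∈ Γ)
    (hc : c ∈ u.names) : ∃ T, (Key.id (.chan c), T) ∈ Γ := by
  rcases u with d | x
  · cases Set.mem_singleton_iff.1 hc
    exact h
  · exact absurd hc (Set.notMem_empty _)

theorem exists_mem_cons_of_names {Γ : Env} {u : Ident} {T : Ty} {c : ℕ} (h : c ∈ u.names) :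
    ∃ U, (Key.id (.chan c), U) ∈ (.id u, T) ::ₘ Γ :=
  exists_mem_of_names ⟨T, Multiset.mem_cons_self _ _⟩ h

/-- The free names of a typed process are in the domain of the environment. -/
theorem Typed.exists_mem_of_mem_fn {Γ : Env} {P : Proc} (h : Typed Γ P) {c : ℕ} (hc : c ∈ P.fn) :
    ∃ T, (Key.id (.chan c), T) ∈ Γ := by
  induction h generalizing c with
  | inp hu _ ih =>
    rcases hc with hc | hc
    · exact exists_mem_cons_of_names hc
    · refine hu.exists_mem ?_
      rcases Env.exists_mem_add.1 (ih hc) with h | ⟨T, h⟩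
      · exact Env.exists_mem_of_subst_shiftVar h
      · have := (List.of_mem_zip (Multiset.mem_coe.1 h)).1
        simp at this
  | @out Γ Δ u vs Ts a P hl hu _ ih =>
    rw [← Multiset.cons_add]
    rcases hc with (hc | ⟨v, hv, hc⟩) | hc
    · exact Env.exists_mem_add.2 (.inl (exists_mem_cons_of_names hc))
    · exact Env.exists_mem_add.2 (.inr (exists_mem_of_names (Env.exists_mem_args hl hv) hc))
    · exact Env.exists_mem_add.2 (.inl (hu.exists_mem (ih hc)))
  | par _ _ ih₁ ih₂ =>
    rcases hc with hc | hc
    · exact Env.exists_mem_add.2 (.inl (ih₁ hc))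
    · exact Env.exists_mem_add.2 (.inr (ih₂ hc))
  | ite hu hv _ _ ih₁ ih₂ =>
    rcases hc with ((hc | hc) | hc) | hc
    · exact exists_mem_of_names hu hc
    · exact exists_mem_of_names hv hc
    · exact ih₁ hc
    · exact ih₂ hc
  | recX _ _ ih =>
    exact Env.exists_mem_of_shiftP (Env.exists_mem_cons_of_ne (by simp) (ih hc))
  | pvar X => exact absurd hc (Set.notMem_empty _)
  | alloc _ ih =>
    exact Env.exists_mem_of_subst_shiftVar (Env.exists_mem_cons_of_ne (by simp) (ih hc))
  | free _ ih =>
    rcases hc with hc | hc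
    · exact exists_mem_cons_of_names hc
    · obtain ⟨T, h⟩ := ih hc
      exact ⟨T, Multiset.mem_cons_of_mem h⟩
  | nil => exact absurd hc (Set.notMem_empty _)
  | resTop _ ih =>
    obtain ⟨d, hd, h⟩ := Env.exists_mem_of_subst_shiftChan
      (Env.exists_mem_cons_of_ne (by simp) (ih hc))
    exact Nat.succ_injective hd ▸ h
  | resBot _ ih =>
    obtain ⟨d, hd, h⟩ := Env.exists_mem_of_subst_shiftChan (ih hc)
    exact Nat.succ_injective hd ▸ h
  | con hs _ ih => exact (Structural.con hs (.refl _)).exists_mem (ih hc)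
  | weak _ ih => exact (Structural.weak (.refl _)).exists_mem (ih hc)
  | sub _ hs ih => exact (Structural.sub (.refl _) hs).exists_mem (ih hc)
  | rev _ ih => exact (Structural.rev (.refl _)).exists_mem (ih hc)

/-! ### Strengthening -/

noncomputable instance : DecidableEq Key := Classical.decEq _

/-- The assumptions that are not about the channel `c`. -/
noncomputable def Env.erase (c : ℕ) (Γ : Env) : Env :=
  Γ.filter fun p => p.1 ≠ .id (.chan c)

theorem Env.erase_cons_self (c : ℕ) (T : Ty) (Γ : Env) :
    Env.erase c ((.id (.chan c), T) ::ₘ Γ) = Env.erase c Γ := by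
  simp [Env.erase]

theorem Env.erase_cons_of_ne {c : ℕ} {k : Key} (hk : k ≠ .id (.chan c)) (T : Ty) (Γ : Env) :
    Env.erase c ((k, T) ::ₘ Γ) = (k, T) ::ₘ Env.erase c Γ := by
  simp [Env.erase, hk]

theorem Env.erase_add (c : ℕ) (Γ Δ : Env) :
    Env.erase c (Γ + Δ) = Env.erase c Γ + Env.erase c Δ := by
  simp [Env.erase]

theorem Env.erase_eq_self {c : ℕ} {Γ : Env} (h : ¬ ∃ T, (Key.id (.chan c), T) ∈ Γ) :
    Env.erase c Γ = Γ :=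
  Multiset.filter_eq_self.2 fun p hp (he : p.1 = _) => h ⟨p.2, by rwa [← he]⟩

theorem Env.exists_mem_erase {c : ℕ} {Γ : Env} {k : Key} (hk : k ≠ .id (.chan c))
    (h : ∃ T, (k, T) ∈ Γ) : ∃ T, (k, T) ∈ Env.erase c Γ := by
  obtain ⟨T, hT⟩ := h
  exact ⟨T, Multiset.mem_filter.2 ⟨hT, hk⟩⟩

theorem Env.not_exists_mem_erase (c : ℕ) (Γ : Env) :
    ¬ ∃ T, (Key.id (.chan c), T) ∈ Env.erase c Γ := by
  rintro ⟨T, hT⟩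
  exact (Multiset.mem_filter.1 hT).2 rfl

theorem Env.erase_map {c d : ℕ} {g : Key → Key}
    (hg : ∀ k, g k = .id (.chan c) ↔ k = .id (.chan d)) (Γ : Env) :
    Env.erase c (Γ.map fun p => (g p.1, p.2)) = (Env.erase d Γ).map fun p => (g p.1, p.2) := by
  simp only [Env.erase, Multiset.filter_map]
  congr 1
  refine Multiset.filter_congr fun p _ => ?_
  exact not_congr (hg p.1)

theorem Env.erase_subst_shiftChan (c : ℕ) (Γ : Env) :
    Env.erase (c + 1) (Env.subst shiftChan Γ) = Env.subst shiftChan (Env.erase c Γ) := by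
  refine Env.erase_map ?_ Γ
  rintro ((d | x) | X) <;> simp [Key.subst, shiftChan]

theorem Env.erase_subst_shiftVar (n c : ℕ) (Γ : Env) :
    Env.erase c (Env.subst (shiftVar n) Γ) = Env.subst (shiftVar n) (Env.erase c Γ) := by
  refine Env.erase_map ?_ Γ
  rintro ((d | x) | X) <;> simp [Key.subst, shiftVar]

theorem Env.erase_shiftP (c : ℕ) (Γ : Env) :
    Env.erase c (Env.shiftP Γ) = Env.shiftP (Env.erase c Γ) := by
  refine Env.erase_map ?_ Γ
  rintro ((d | x) | X) <;> simp [Key.shiftP]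

theorem Env.erase_zero_subst_shiftChan (Γ : Env) :
    Env.erase 0 (Env.subst shiftChan Γ) = Env.subst shiftChan Γ := by
  refine Env.erase_eq_self fun h => ?_
  obtain ⟨d, hd, _⟩ := Env.exists_mem_of_subst_shiftChan h
  exact absurd hd.symm (Nat.succ_ne_zero d)

theorem key_ne_of_notMem_names {u : Ident} {c : ℕ} (h : c ∉ u.names) :
    Key.id u ≠ .id (.chan c) := by
  rintro ⟨⟩
  exact h rfl

theorem Env.erase_args {c : ℕ} {us : List Ident} (h : ∀ u ∈ us, c ∉ u.names) (Ts : List Ty) :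
    Env.erase c (Env.args us Ts) = Env.args us Ts := by
  refine Env.erase_eq_self ?_
  rintro ⟨T, hT⟩
  obtain ⟨u, hu, he⟩ := List.mem_map.1 (List.of_mem_zip (Multiset.mem_coe.1 hT)).1
  exact key_ne_of_notMem_names (h u hu) he

theorem Uses.erase {Γ Δ : Env} {u : Ident} {Ts : List Ty} {a : Attr} {c : ℕ} (hc : c ∉ u.names)
    (h : Uses Γ u Ts a Δ) : Uses (Env.erase c Γ) u Ts a (Env.erase c Δ) := by
  cases h with
  | aff => exact .aff
  | unr => rw [Env.erase_cons_of_ne (key_ne_of_notMem_names hc)]; exact .unr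
  | unq i => rw [Env.erase_cons_of_ne (key_ne_of_notMem_names hc)]; exact .unq i

theorem Structural.erase {Γ Δ : Env} (h : Structural Γ Δ) (c : ℕ) :
    Structural (Env.erase c Γ) (Env.erase c Δ) := by
  exact h.filter (fun k => k ≠ .id (.chan c))

/-- Logical rules mention only names that occur in the process, so assumptions about an absent
channel serve structural rules alone, and these survive or vanish under filtering. -/
theorem Typed.erase {Γ : Env} {P : Proc} (h : Typed Γ P) {c : ℕ} (hc : c ∉ P.fn) :
    Typed (Env.erase c Γ) P := by
  induction h generalizing c with
  | inp hu _ ih =>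
    simp only [Proc.fn, Set.mem_union, not_or] at hc
    rw [Env.erase_cons_of_ne (key_ne_of_notMem_names hc.1)]
    refine .inp (hu.erase hc.1) ?_
    have := ih hc.2
    rwa [Env.erase_add, Env.erase_subst_shiftVar, Env.erase_args] at this
    intro u hu
    obtain ⟨x, _, rfl⟩ := List.mem_map.1 hu
    exact Set.notMem_empty _
  | out hl hu _ ih =>
    simp only [Proc.fn, Set.mem_union, not_or, Set.mem_ofPred_eq, not_exists, not_and] at hc
    rw [Env.erase_cons_of_ne (key_ne_of_notMem_names hc.1.1), Env.erase_add,
      Env.erase_args hc.1.2]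
    exact .out hl (hu.erase hc.1.1) (ih hc.2)
  | par _ _ ih₁ ih₂ =>
    simp only [Proc.fn, Set.mem_union, not_or] at hc
    rw [Env.erase_add]
    exact .par (ih₁ hc.1) (ih₂ hc.2)
  | ite hu hv _ _ ih₁ ih₂ =>
    simp only [Proc.fn, Set.mem_union, not_or] at hc
    exact .ite (Env.exists_mem_erase (key_ne_of_notMem_names hc.1.1.1) hu)
      (Env.exists_mem_erase (key_ne_of_notMem_names hc.1.1.2) hv) (ih₁ hc.1.2) (ih₂ hc.2)
  | recX hΓ _ ih =>
    refine .recX (fun p hp => hΓ p (Multiset.mem_of_mem_filter hp)) ?_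
    have := ih hc
    rwa [Env.erase_cons_of_ne (by simp), Env.erase_shiftP] at this
  | pvar X =>
    rw [Env.erase_eq_self (by simp)]
    exact .pvar X
  | alloc _ ih =>
    have := ih hc
    rw [Env.erase_cons_of_ne (by simp), Env.erase_subst_shiftVar] at this
    exact .alloc this
  | free _ ih =>
    simp only [Proc.fn, Set.mem_union, not_or] at hc
    rw [Env.erase_cons_of_ne (key_ne_of_notMem_names hc.1)]
    exact .free (ih hc.2)
  | nil => exact .nil
  | resTop _ ih =>
    have := ih (c := c + 1) hc
    rw [Env.erase_cons_of_ne (by simp), Env.erase_subst_shiftChan] at this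
    exact .resTop this
  | resBot _ ih =>
    have := ih (c := c + 1) hc
    rw [Env.erase_subst_shiftChan] at this
    exact .resBot this
  | con hs _ ih => exact ((Structural.con hs (.refl _)).erase c).typed (ih hc)
  | weak _ ih => exact ((Structural.weak (.refl _)).erase c).typed (ih hc)
  | sub _ hs ih => exact ((Structural.sub (.refl _) hs).erase c).typed (ih hc)
  | rev _ ih => exact ((Structural.rev (.refl _)).erase c).typed (ih hc)

theorem Proc.zero_notMem_fn_subst_shiftChan (P : Proc) : 0 ∉ (P.subst shiftChan).fn := by
  intro h
  obtain ⟨(d | x), hu⟩ := Proc.fn_subst h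
  · exact absurd hu.symm (Nat.succ_ne_zero d)
  · exact hu

theorem Env.subst_unshiftChan (Γ : Env) :
    Env.subst unshiftChan (Env.subst shiftChan Γ) = Γ := by
  rw [Env.subst_subst, unshiftChan_comp_shiftChan, Env.subst_id]

theorem Proc.subst_unshiftChan (P : Proc) : (P.subst shiftChan).subst unshiftChan = P := by
  rw [Proc.subst_subst, unshiftChan_comp_shiftChan, Proc.subst_id]

/-- An environment without assumptions about the channel `0` is a shifted one. -/
theorem Env.subst_shiftChan_unshiftChan {Γ : Env} (h : ¬ ∃ T, (Key.id (.chan 0), T) ∈ Γ) :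
    Env.subst shiftChan (Env.subst unshiftChan Γ) = Γ := by
  rw [Env.subst_subst, Env.subst]
  conv_rhs => rw [← Multiset.map_id Γ]
  refine Multiset.map_congr rfl fun p hp => ?_
  rcases p with ⟨((_ | d) | x) | X, T⟩
  · exact absurd ⟨T, hp⟩ h
  all_goals rfl

theorem typed_subst_shiftChan_iff {Γ : Env} {P : Proc} :
    Typed (Env.subst shiftChan Γ) (P.subst shiftChan) ↔ Typed Γ P := by
  refine ⟨fun h => ?_, fun h => h.subst _⟩
  have := h.subst unshiftChan
  rwa [Env.subst_unshiftChan, Proc.subst_unshiftChan] at this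

/-! ### Structural equivalence preserves typing -/

theorem typed_par_nil_iff {Γ : Env} {P : Proc} : Typed Γ (.par P .nil) ↔ Typed Γ P := by
  constructor
  · intro h
    obtain ⟨Γ₁, Γ₂, hs, hP, -⟩ := h.par_inv
    exact hs.typed hP.weaken
  · intro h
    have := Typed.par h .nil
    rwa [add_zero] at this

theorem Typed.par_comm {Γ : Env} {P Q : Proc} (h : Typed Γ (.par P Q)) : Typed Γ (.par Q P) := by
  obtain ⟨Γ₁, Γ₂, hs, hP, hQ⟩ := h.par_inv
  rw [add_comm] at hs
  exact hs.typed (.par hQ hP)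

theorem typed_par_assoc_iff {Γ : Env} {P Q R : Proc} :
    Typed Γ (.par (.par P Q) R) ↔ Typed Γ (.par P (.par Q R)) := by
  constructor
  · intro h
    obtain ⟨Γ₁, Γ₂, hs, hPQ, hR⟩ := h.par_inv
    obtain ⟨Γ₃, Γ₄, hs', hP, hQ⟩ := hPQ.par_inv
    refine hs.typed ((hs'.add_right Γ₂).typed ?_)
    rw [add_assoc]
    exact .par hP (.par hQ hR)
  · intro h
    obtain ⟨Γ₁, Γ₂, hs, hP, hQR⟩ := h.par_inv
    obtain ⟨Γ₃, Γ₄, hs', hQ, hR⟩ := hQR.par_inv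
    refine hs.typed ((hs'.add_left Γ₁).typed ?_)
    rw [← add_assoc]
    exact .par (.par hP hQ) hR

theorem typed_scope_iff {Γ : Env} (s : CState) {P : Proc} :
    Typed Γ (.res s (P.subst shiftChan)) ↔ Typed Γ P := by
  constructor
  · intro h
    refine typed_subst_shiftChan_iff.1 ?_
    cases s with
    | top =>
      obtain ⟨T, hP⟩ := h.resTop_inv
      have := hP.erase P.zero_notMem_fn_subst_shiftChan
      rwa [Env.erase_cons_self, Env.erase_zero_subst_shiftChan] at this
    | bot => exact h.resBot_inv
  · intro h
    cases s with
    -- Any type would do, as the assumption is discarded at once.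
    | top => exact .resTop (T := .proc) (.weak (h.subst shiftChan))
    | bot => exact .resBot (h.subst shiftChan)

theorem Structural.of_cons_subst_shiftChan {Γ Δ : Env} {T : Ty}
    (h : Structural ((.id (.chan 0), T) ::ₘ Env.subst shiftChan Γ) Δ) :
    Structural {(.id (.chan 0), T)} (Δ.filter fun p => p.1 = .id (.chan 0)) := by
  have := h.filter (fun k => k = .id (.chan 0))
  have h0 : (Env.subst shiftChan Γ).filter (fun p => p.1 = .id (.chan 0)) = 0 := by
    refine Multiset.filter_eq_nil.2 fun p hp he => ?_
    obtain ⟨k, U⟩ := p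
    obtain rfl : k = .id (.chan 0) := he
    obtain ⟨d, hd, _⟩ := Env.exists_mem_of_subst_shiftChan ⟨U, hp⟩
    exact absurd hd.symm (Nat.succ_ne_zero d)
  simpa [h0] using this

theorem Env.filter_add_erase (c : ℕ) (Γ : Env) :
    (Γ.filter fun p => p.1 = .id (.chan c)) + Env.erase c Γ = Γ :=
  Multiset.filter_add_not _ Γ

theorem Typed.extrude {Γ : Env} {s : CState} {P Q : Proc} (h : Typed Γ (.par P (.res s Q))) :
    Typed Γ (.res s (.par (P.subst shiftChan) Q)) := by
  obtain ⟨Γ₁, Γ₂, hs, hP, hQ⟩ := h.par_inv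
  refine hs.typed ?_
  cases s with
  | top =>
    obtain ⟨T, hQ⟩ := hQ.resTop_inv
    have := Typed.par (hP.subst shiftChan) hQ
    rw [Multiset.add_cons, ← Env.subst_add] at this
    exact .resTop this
  | bot =>
    have := Typed.par (hP.subst shiftChan) hQ.resBot_inv
    rw [← Env.subst_add] at this
    exact .resBot this

/-- The delicate direction of scope extrusion: inverting the parallel composition may have given
part of the assumption about the scoped channel to `P`. That part can be erased, because the channel
is not free in the shifted `P`. -/
theorem Typed.intrude {Γ : Env} {s : CState} {P Q : Proc}
    (h : Typed Γ (.res s (.par (P.subst shiftChan) Q))) : Typed Γ (.par P (.res s Q)) := by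
  -- Both shares lose their assumptions about channel `0` and are shifted back; the same operation
  -- turns the opened environment `Θ` into `Γ`.
  have key : ∀ {Θ Γ₁ Γ₂ : Env}, Structural Θ (Γ₁ + Γ₂) →
      Env.erase 0 Θ = Env.subst shiftChan Γ → Typed Γ₁ (P.subst shiftChan) →
      ∃ Δ₁ Δ₂, Structural Γ (Δ₁ + Δ₂) ∧ Typed Δ₁ P ∧ Env.erase 0 Γ₂ = Env.subst shiftChan Δ₂ := by
    intro Θ Γ₁ Γ₂ hs hΘ hP
    refine ⟨Env.subst unshiftChan (Env.erase 0 Γ₁), Env.subst unshiftChan (Env.erase 0 Γ₂),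
      ?_, ?_, ?_⟩
    · have := (hs.erase 0).subst unshiftChan
      rwa [hΘ, Env.subst_unshiftChan, Env.erase_add, Env.subst_add] at this
    · refine typed_subst_shiftChan_iff.1 ?_
      rw [Env.subst_shiftChan_unshiftChan (Env.not_exists_mem_erase 0 _)]
      exact hP.erase P.zero_notMem_fn_subst_shiftChan
    · rw [Env.subst_shiftChan_unshiftChan (Env.not_exists_mem_erase 0 _)]
  cases s with
  | top =>
    obtain ⟨T, h⟩ := h.resTop_inv
    obtain ⟨Γ₁, Γ₂, hs, hP, hQ⟩ := h.par_inv
    obtain ⟨Δ₁, Δ₂, hs', hP', he⟩ := key hs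
      (by rw [Env.erase_cons_self, Env.erase_zero_subst_shiftChan]) hP
    refine hs'.typed (.par hP' (.resTop (T := T) ?_))
    rw [← he, ← Multiset.singleton_add]
    have h0 := hs.of_cons_subst_shiftChan
    rw [Multiset.filter_add] at h0
    -- The assumptions about channel `0` in both shares descend from the single type `T`; weakening
    -- away those of `Γ₁` leaves those of `Γ₂`, so `T` still serves for `Q` alone.
    refine (((h0.trans (.add_weak _ _)).add_right _)).typed ?_
    rwa [Env.filter_add_erase]
  | bot =>
    obtain ⟨Γ₁, Γ₂, hs, hP, hQ⟩ := h.resBot_inv.par_inv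
    obtain ⟨Δ₁, Δ₂, hs', hP', he⟩ := key hs (Env.erase_zero_subst_shiftChan Γ) hP
    refine hs'.typed (.par hP' (.resBot ?_))
    have hn : ¬ ∃ T, (Key.id (.chan 0), T) ∈ Γ₂ := by
      rintro ⟨T, hT⟩
      obtain ⟨d, hd, _⟩ := Env.exists_mem_of_subst_shiftChan
        (hs.exists_mem (Env.exists_mem_add.2 (.inr ⟨T, hT⟩)))
      exact absurd hd.symm (Nat.succ_ne_zero d)
    rwa [← he, Env.erase_eq_self hn]

theorem swapChan_comp_shiftChan_comp_shiftChan :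
    swapChan ∘ shiftChan ∘ shiftChan = shiftChan ∘ shiftChan := by
  funext u
  cases u <;> rfl

theorem swapChan_comp_swapChan : swapChan ∘ swapChan = id := by
  funext u
  rcases u with (_ | _ | c) | x <;> rfl

theorem Typed.swap {Γ : Env} {s t : CState} {P : Proc} (h : Typed Γ (.res s (.res t P))) :
    Typed Γ (.res t (.res s (P.subst swapChan))) := by
  have hΓ : Env.subst swapChan (Env.subst shiftChan (Env.subst shiftChan Γ)) =
      Env.subst shiftChan (Env.subst shiftChan Γ) := by
    rw [Env.subst_subst, Env.subst_subst, Env.subst_subst,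
      ← swapChan_comp_shiftChan_comp_shiftChan]
    rfl
  rcases s with _ | _ <;> rcases t with _ | _
  · obtain ⟨S, h⟩ := h.resTop_inv
    obtain ⟨T, h⟩ := h.resTop_inv
    have := h.subst swapChan
    rw [Env.subst_cons, Env.subst_cons, Env.subst_cons, hΓ, Multiset.cons_swap] at this
    refine .resTop (T := T) (.resTop (T := S) ?_)
    rw [Env.subst_cons]
    exact this
  · obtain ⟨S, h⟩ := h.resTop_inv
    have := h.resBot_inv.subst swapChan
    rw [Env.subst_cons, Env.subst_cons, hΓ] at this
    exact .resBot (.resTop this)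
  · obtain ⟨T, h⟩ := h.resBot_inv.resTop_inv
    have := h.subst swapChan
    rw [Env.subst_cons, hΓ] at this
    refine .resTop (T := T) (.resBot ?_)
    rw [Env.subst_cons]
    exact this
  · have := h.resBot_inv.resBot_inv.subst swapChan
    rw [hΓ] at this
    exact .resBot (.resBot this)

/-- An equivalence for one fixed environment, so that symmetry and transitivity are immediate and
the congruence cases need only inversion. -/
theorem SEq.typed_iff {P Q : Proc} (h : SEq P Q) {Γ : Env} : Typed Γ P ↔ Typed Γ Q := by
  induction h generalizing Γ with
  | refl P => rfl
  | symm _ ih => exact ih.symm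
  | trans _ _ ih₁ ih₂ => exact ih₁.trans ih₂
  | parNil P => exact typed_par_nil_iff
  | parComm P Q => exact ⟨.par_comm, .par_comm⟩
  | parAssoc P Q R => exact typed_par_assoc_iff
  | scope s P => exact (typed_scope_iff s).symm
  | extrude s P Q => exact ⟨.extrude, .intrude⟩
  | swap s t P =>
    refine ⟨.swap, fun h => ?_⟩
    -- Exchanging the two channels is an involution, so one direction gives the other.
    have := h.swap
    rwa [Proc.subst_subst, swapChan_comp_swapChan, Proc.subst_id] at this
  | out u vs _ ih =>
    constructor <;> intro h <;> obtain ⟨Δ, hs, Γ', Δ', Ts, a, hl, hu, hP, rfl⟩ := h.inversion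
    · exact hs.typed (.out hl hu (ih.1 hP))
    · exact hs.typed (.out hl hu (ih.2 hP))
  | inp u n _ ih =>
    constructor <;> intro h <;> obtain ⟨Δ, hs, Γ', Δ', Ts, a, rfl, hu, hP, rfl⟩ := h.inversion
    · exact hs.typed (.inp hu (ih.1 hP))
    · exact hs.typed (.inp hu (ih.2 hP))
  | ite u v _ _ ih₁ ih₂ =>
    constructor <;> intro h <;> obtain ⟨hu, hv, hP, hQ⟩ := h.ite_inv
    · exact .ite hu hv (ih₁.1 hP) (ih₂.1 hQ)
    · exact .ite hu hv (ih₁.2 hP) (ih₂.2 hQ)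
  | recX _ ih =>
    constructor <;> intro h <;> obtain ⟨Δ, hs, hΔ, hP⟩ := h.inversion
    · exact hs.typed (.recX hΔ (ih.1 hP))
    · exact hs.typed (.recX hΔ (ih.2 hP))
  | par _ _ ih₁ ih₂ =>
    constructor <;> intro h <;> obtain ⟨Γ₁, Γ₂, hs, hP, hQ⟩ := h.par_inv
    · exact hs.typed (.par (ih₁.1 hP) (ih₂.1 hQ))
    · exact hs.typed (.par (ih₁.2 hP) (ih₂.2 hQ))
  | res s _ ih =>
    cases s with
    | top =>
      constructor <;> intro h <;> obtain ⟨T, hP⟩ := h.resTop_inv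
      · exact .resTop (ih.1 hP)
      · exact .resTop (ih.2 hP)
    | bot => exact ⟨fun h => .resBot (ih.1 h.resBot_inv), fun h => .resBot (ih.2 h.resBot_inv)⟩
  | alloc _ ih =>
    constructor <;> intro h <;> obtain ⟨T, hP⟩ := h.alloc_inv
    · exact .alloc (ih.1 hP)
    · exact .alloc (ih.2 hP)
  | free u _ ih =>
    constructor <;> intro h <;> obtain ⟨Δ, hs, Γ', Ts, hP, rfl⟩ := h.inversion
    · exact hs.typed (.free (ih.1 hP))
    · exact hs.typed (.free (ih.2 hP))

/-! ### Coherent environments -/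

/-- The multisets of types that the structural rules produce from a single type. -/
def Coherent (M : Multiset Ty) : Prop :=
  (∀ T ∈ M, T = .proc) ∨ ∃ Ts,
    (∀ T ∈ M, T = .chan Ts .unr ∨ T = .chan Ts .aff) ∨
    ∃ i n, n ≤ i ∧ M = .chan Ts (.unq i) ::ₘ Multiset.replicate n (.chan Ts .aff)

theorem coherent_cons_proc {M : Multiset Ty} :
    Coherent (.proc ::ₘ M) ↔ ∀ T ∈ M, T = .proc := by
  constructor
  · rintro (h | ⟨Ts, h | ⟨i, n, _, h⟩⟩)
    · exact fun T hT => h T (Multiset.mem_cons_of_mem hT)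
    · simpa using h .proc (Multiset.mem_cons_self _ _)
    · have : Ty.proc ∈ _ := h ▸ Multiset.mem_cons_self _ _
      simp [Multiset.mem_replicate] at this
  · intro h
    exact .inl fun T hT => (Multiset.mem_cons.1 hT).elim _root_.id (h T)

theorem coherent_cons_unr {M : Multiset Ty} {Ts : List Ty} :
    Coherent (.chan Ts .unr ::ₘ M) ↔ ∀ T ∈ M, T = .chan Ts .unr ∨ T = .chan Ts .aff := by
  constructor
  · rintro (h | ⟨Us, h | ⟨i, n, _, h⟩⟩)
    · simpa using h _ (Multiset.mem_cons_self _ _)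
    · have h' := h _ (Multiset.mem_cons_self _ _)
      simp only [Ty.chan.injEq, and_true, reduceCtorEq, and_false, or_false] at h'
      exact fun T hT => h' ▸ h T (Multiset.mem_cons_of_mem hT)
    · have : Ty.chan Ts .unr ∈ _ := h ▸ Multiset.mem_cons_self _ _
      simp [Multiset.mem_replicate] at this
  · intro h
    exact .inr ⟨Ts, .inl fun T hT => (Multiset.mem_cons.1 hT).elim .inl (h T)⟩

/-- Each split of a unique type yields one affine copy and raises the index by one, while subtyping
can only raise it further. Hence the index bounds the number of affine copies. -/
theorem coherent_cons_unq {M : Multiset Ty} {Ts : List Ty} {i : ℕ} :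
    Coherent (.chan Ts (.unq i) ::ₘ M) ↔ ∃ n ≤ i, M = Multiset.replicate n (.chan Ts .aff) := by
  constructor
  · rintro (h | ⟨Us, h | ⟨j, n, hn, h⟩⟩)
    · simpa using h _ (Multiset.mem_cons_self _ _)
    · simpa using h _ (Multiset.mem_cons_self _ _)
    · have h' : Ty.chan Ts (.unq i) ∈ _ := h ▸ Multiset.mem_cons_self _ _
      simp only [Multiset.mem_cons, Ty.chan.injEq, Attr.unq.injEq, Multiset.mem_replicate,
        reduceCtorEq, and_false, or_false] at h'
      obtain ⟨rfl, rfl⟩ := h'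
      exact ⟨n, hn, (Multiset.cons_inj_right _).1 h⟩
  · rintro ⟨n, hn, rfl⟩
    exact .inr ⟨Ts, .inr ⟨i, n, hn, rfl⟩⟩

/-- The inequality is strict because the displayed affine type is itself one of the at most `i`
copies. -/
theorem coherent_cons_aff {M : Multiset Ty} {Ts : List Ty} :
    Coherent (.chan Ts .aff ::ₘ M) ↔ (∀ T ∈ M, T = .chan Ts .unr ∨ T = .chan Ts .aff) ∨
      ∃ i n, n < i ∧ M = .chan Ts (.unq i) ::ₘ Multiset.replicate n (.chan Ts .aff) := by
  constructor
  · rintro (h | ⟨Us, h | ⟨i, n, hn, h⟩⟩)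
    · simpa using h _ (Multiset.mem_cons_self _ _)
    · have h' := h _ (Multiset.mem_cons_self _ _)
      simp only [Ty.chan.injEq, and_true, reduceCtorEq, and_false, false_or] at h'
      exact .inl fun T hT => h' ▸ h T (Multiset.mem_cons_of_mem hT)
    · rcases Multiset.cons_eq_cons.1 h with ⟨h, _⟩ | ⟨_, N, rfl, hN⟩
      · simp at h
      · have hm : Ty.chan Ts .aff ∈ Multiset.replicate n (Ty.chan Us .aff) :=
          hN ▸ Multiset.mem_cons_self _ _
        obtain ⟨h0, h1⟩ := Multiset.mem_replicate.1 hm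
        cases h1
        obtain ⟨m, rfl⟩ := Nat.exists_eq_succ_of_ne_zero h0
        rw [Multiset.replicate_succ, Multiset.cons_inj_right] at hN
        exact .inr ⟨i, m, hn, by rw [hN]⟩
  · rintro (h | ⟨i, n, hn, rfl⟩)
    · exact .inr ⟨Ts, .inl fun T hT => (Multiset.mem_cons.1 hT).elim .inr (h T)⟩
    · refine .inr ⟨Ts, .inr ⟨i, n + 1, hn, ?_⟩⟩
      rw [Multiset.replicate_succ, Multiset.cons_swap]

theorem coherent_zero : Coherent 0 := .inl fun T hT => absurd hT (Multiset.notMem_zero T)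

theorem coherent_replicate_aff (n : ℕ) (Ts : List Ty) :
    Coherent (Multiset.replicate n (.chan Ts .aff)) :=
  .inr ⟨Ts, .inl fun _ hT => .inr (Multiset.eq_of_mem_replicate hT)⟩

theorem coherent_singleton (T : Ty) : Coherent {T} := by
  rcases T with ⟨Ts, _ | _ | i⟩ | _
  · exact coherent_replicate_aff 1 Ts
  · exact coherent_cons_unr.2 (by simp)
  · exact coherent_cons_unq.2 ⟨0, Nat.zero_le _, rfl⟩
  · exact coherent_cons_proc.2 (by simp)

theorem Coherent.of_cons {T : Ty} {M : Multiset Ty} (h : Coherent (T ::ₘ M)) : Coherent M := by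
  rcases T with ⟨Ts, _ | _ | i⟩ | _
  · rcases coherent_cons_aff.1 h with h | ⟨i, n, hn, h⟩
    · exact .inr ⟨Ts, .inl h⟩
    · exact .inr ⟨Ts, .inr ⟨i, n, hn.le, h⟩⟩
  · exact .inr ⟨Ts, .inl (coherent_cons_unr.1 h)⟩
  · obtain ⟨n, _, rfl⟩ := coherent_cons_unq.1 h
    exact coherent_replicate_aff n Ts
  · exact .inl (coherent_cons_proc.1 h)

theorem Coherent.split {T T₁ T₂ : Ty} {M : Multiset Ty} (hs : Split T T₁ T₂)
    (h : Coherent (T ::ₘ M)) : Coherent (T₁ ::ₘ T₂ ::ₘ M) := by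
  cases hs with
  | unr Ts =>
    have := coherent_cons_unr.1 h
    exact coherent_cons_unr.2 fun T hT => (Multiset.mem_cons.1 hT).elim .inl (this T)
  | proc =>
    have := coherent_cons_proc.1 h
    exact coherent_cons_proc.2 fun T hT => (Multiset.mem_cons.1 hT).elim _root_.id (this T)
  | unq Ts i =>
    obtain ⟨n, hn, rfl⟩ := coherent_cons_unq.1 h
    exact coherent_cons_aff.2 (.inr ⟨i + 1, n, Nat.lt_succ_of_le hn, rfl⟩)

theorem Coherent.sub {T₁ T₂ : Ty} {M : Multiset Ty} (hs : SubTy T₁ T₂)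
    (h : Coherent (T₁ ::ₘ M)) : Coherent (T₂ ::ₘ M) := by
  obtain ⟨Ts, hs⟩ := hs
  cases hs with
  | indx i =>
    obtain ⟨n, hn, rfl⟩ := coherent_cons_unq.1 h
    exact coherent_cons_unq.2 ⟨n, hn.trans (Nat.le_succ i), rfl⟩
  | unq i =>
    obtain ⟨n, _, rfl⟩ := coherent_cons_unq.1 h
    exact coherent_cons_unr.2 fun T hT => .inr (Multiset.eq_of_mem_replicate hT)
  | aff => exact coherent_cons_aff.2 (.inl (coherent_cons_unr.1 h))

/-- Uniqueness in the literal sense. It lets a channel be freed, and lets its payload type be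
revised without any other assumption that could disagree. -/
theorem coherent_cons_unq_zero {Ts : List Ty} {M : Multiset Ty} :
    Coherent (.chan Ts (.unq 0) ::ₘ M) ↔ M = 0 := by
  rw [coherent_cons_unq]
  constructor
  · rintro ⟨n, hn, rfl⟩
    rw [Nat.le_zero.1 hn, Multiset.replicate_zero]
  · rintro rfl
    exact ⟨0, le_rfl, rfl⟩

/-- Ensures that sender and receiver agree on the types of the transmitted names. -/
theorem Coherent.payload_eq {M : Multiset Ty} (h : Coherent M) {Ts Us : List Ty} {a b : Attr}
    (ha : .chan Ts a ∈ M) (hb : .chan Us b ∈ M) : Ts = Us := by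
  have : ∃ Vs, ∀ T ∈ M, T = .proc ∨ ∃ c, T = .chan Vs c := by
    rcases h with h | ⟨Vs, h | ⟨i, n, _, rfl⟩⟩
    · exact ⟨[], fun T hT => .inl (h T hT)⟩
    · exact ⟨Vs, fun T hT => .inr ((h T hT).elim (fun h => ⟨_, h⟩) fun h => ⟨_, h⟩)⟩
    · exact ⟨Vs, fun T hT => .inr ((Multiset.mem_cons.1 hT).elim (fun h => ⟨_, h⟩)
        fun h => ⟨_, Multiset.eq_of_mem_replicate h⟩)⟩
  obtain ⟨Vs, h⟩ := this
  have := h _ ha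
  have := h _ hb
  simp_all

/-- The effect of a communication on a unique channel: with one affine copy spent, the lower index
still bounds the remaining ones. -/
theorem Coherent.use_unq {M : Multiset Ty} {Ts : List Ty} {i : ℕ}
    (h : Coherent (.chan Ts (.unq (i + 1)) ::ₘ .chan Ts .aff ::ₘ M)) :
    Coherent (.chan Ts (.unq i) ::ₘ M) := by
  obtain ⟨n, hn, h⟩ := coherent_cons_unq.1 h
  cases n with
  | zero => simp at h
  | succ n =>
    rw [Multiset.replicate_succ, Multiset.cons_inj_right] at h
    exact coherent_cons_unq.2 ⟨n, Nat.le_of_succ_le_succ hn, h⟩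

/-- Coherent types for one key arise from a single type by the structural rules. -/
theorem Coherent.exists_structural {M : Multiset Ty} (h : Coherent M) (k : Key) :
    ∃ T, Structural {(k, T)} (M.map (Prod.mk k)) := by
  rcases h with h | ⟨Ts, h | ⟨i, n, hn, rfl⟩⟩
  · refine ⟨.proc, ?_⟩
    induction M using Multiset.induction with
    | empty => exact .weak (.refl _)
    | cons T M ih =>
      obtain rfl := h T (Multiset.mem_cons_self _ _)
      rw [Multiset.map_cons]
      exact .con (Γ := 0) .proc
        ((ih fun U hU => h U (Multiset.mem_cons_of_mem hU)).cons (k, .proc))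
  · refine ⟨.chan Ts .unr, ?_⟩
    induction M using Multiset.induction with
    | empty => exact .weak (.refl _)
    | cons T M ih =>
      rw [Multiset.map_cons]
      have := ih fun U hU => h U (Multiset.mem_cons_of_mem hU)
      -- One copy pays for `T`, lowered to affine by subtyping if necessary; the other pays for the
      -- rest.
      refine .con (Γ := 0) (.unr Ts) ?_
      rcases h T (Multiset.mem_cons_self _ _) with rfl | rfl
      · exact this.cons _
      · exact .sub (this.cons _) (.typ Ts .aff)
  -- Splitting off `n` affine copies raises the index by `n`, so the starting index must be `i - n`;
  -- this is where the bound `n ≤ i` is needed.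
  · obtain ⟨j, rfl⟩ := Nat.exists_eq_add_of_le hn
    clear hn
    refine ⟨.chan Ts (.unq j), ?_⟩
    rw [Multiset.map_cons, Multiset.map_replicate]
    induction n generalizing j with
    | zero =>
      rw [zero_add]
      exact .refl _
    | succ n ih =>
      refine .con (Γ := 0) (.unq Ts j) ?_
      have := (ih (j + 1)).cons (k, .chan Ts .aff)
      rw [Multiset.replicate_succ, Multiset.cons_swap (k, Ty.chan Ts (.unq _)),
        show n + 1 + j = n + (j + 1) by omega]
      exact this

/-- The types that `Γ` assigns to `k`. -/
noncomputable def Env.types (k : Key) (Γ : Env) : Multiset Ty :=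
  (Γ.filter fun p => p.1 = k).map Prod.snd

theorem Env.types_cons_self (k : Key) (T : Ty) (Γ : Env) :
    Env.types k ((k, T) ::ₘ Γ) = T ::ₘ Env.types k Γ := by
  simp [Env.types]

theorem Env.types_cons_of_ne {k k' : Key} (h : k' ≠ k) (T : Ty) (Γ : Env) :
    Env.types k ((k', T) ::ₘ Γ) = Env.types k Γ := by
  simp [Env.types, h]

theorem Env.types_add (k : Key) (Γ Δ : Env) :
    Env.types k (Γ + Δ) = Env.types k Γ + Env.types k Δ := by
  simp [Env.types]

theorem Env.mem_types {k : Key} {T : Ty} {Γ : Env} : T ∈ Env.types k Γ ↔ (k, T) ∈ Γ := by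
  simp [Env.types]

theorem Env.types_eq_zero {k : Key} {Γ : Env} : Env.types k Γ = 0 ↔ ¬ ∃ T, (k, T) ∈ Γ := by
  simp only [Multiset.eq_zero_iff_forall_notMem, Env.mem_types, not_exists]

theorem Env.map_types (k : Key) (Γ : Env) :
    (Env.types k Γ).map (Prod.mk k) = Γ.filter fun p => p.1 = k := by
  rw [Env.types, Multiset.map_map]
  conv_rhs => rw [← Multiset.map_id (Γ.filter fun p => p.1 = k)]
  refine Multiset.map_congr rfl fun p hp => ?_
  obtain rfl := (Multiset.mem_filter.1 hp).2
  rfl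

theorem Env.types_map {g : Key → Key} (hg : Function.Injective g) (k : Key) (Γ : Env) :
    Env.types (g k) (Γ.map fun p => (g p.1, p.2)) = Env.types k Γ := by
  rw [Env.types, Multiset.filter_map, Multiset.map_map, Env.types]
  refine Multiset.map_congr (Multiset.filter_congr fun p _ => ?_) fun _ _ => rfl
  exact hg.eq_iff

/-- The types of each key are coherent, and the channels in the domain are allocated. -/
structure Env.Valid (σ : Store) (Γ : Env) : Prop where
  coherent : ∀ k, Coherent (Env.types k Γ)
  allocated : ∀ c T, (Key.id (.chan c), T) ∈ Γ → σ c = some .top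

theorem Env.types_map_mk_self (k : Key) (M : Multiset Ty) :
    Env.types k (M.map (Prod.mk k)) = M := by
  rw [Env.types, Multiset.filter_eq_self.2 (by simp), Multiset.map_map]
  exact Multiset.map_id M

theorem Env.types_map_mk_of_ne {k k' : Key} (h : k ≠ k') (M : Multiset Ty) :
    Env.types k' (M.map (Prod.mk k)) = 0 := by
  refine Env.types_eq_zero.2 ?_
  rintro ⟨T, hT⟩
  obtain ⟨_, _, he⟩ := Multiset.mem_map.1 hT
  exact h (congrArg Prod.fst he)

/-- A change of types at one key needs a check of coherence only there. Nonemptiness of `M` means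
that the key was already in the domain, so a channel gaining new types is known to be allocated. -/
theorem Env.Valid.replace {σ : Store} {Γ : Env} {k : Key} {M N : Multiset Ty}
    (h : Env.Valid σ (M.map (Prod.mk k) + Γ)) (hM : M ≠ 0)
    (hc : Coherent (M + Env.types k Γ) → Coherent (N + Env.types k Γ)) :
    Env.Valid σ (N.map (Prod.mk k) + Γ) := by
  refine ⟨fun k' => ?_, fun c T hT => ?_⟩
  · have := h.coherent k'
    rw [Env.types_add] at this ⊢
    by_cases hk : k = k'
    · subst hk
      rw [Env.types_map_mk_self] at this ⊢
      exact hc this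
    · rw [Env.types_map_mk_of_ne hk] at this ⊢
      exact this
  · rcases Multiset.mem_add.1 hT with hT | hT
    · obtain ⟨U, hU⟩ := Multiset.exists_mem_of_ne_zero hM
      obtain ⟨_, _, he⟩ := Multiset.mem_map.1 hT
      obtain rfl := congrArg Prod.fst he
      exact h.allocated c U (Multiset.mem_add.2 (.inl (Multiset.mem_map_of_mem _ hU)))
    · exact h.allocated c T (Multiset.mem_add.2 (.inr hT))

theorem Env.Valid.replace_cons {σ : Store} {Γ : Env} {k : Key} {T T' : Ty}
    (h : Env.Valid σ ((k, T) ::ₘ Γ))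
    (hc : Coherent (T ::ₘ Env.types k Γ) → Coherent (T' ::ₘ Env.types k Γ)) :
    Env.Valid σ ((k, T') ::ₘ Γ) :=
  Env.Valid.replace (M := {T}) (N := {T'}) h (Multiset.singleton_ne_zero T) hc

theorem Env.Valid.of_cons {σ : Store} {Γ : Env} {k : Key} {T : Ty}
    (h : Env.Valid σ ((k, T) ::ₘ Γ)) : Env.Valid σ Γ := by
  have := Env.Valid.replace (M := {T}) (N := 0) h (Multiset.singleton_ne_zero T)
    fun h => by rw [zero_add]; exact h.of_cons
  rwa [Multiset.map_zero, zero_add] at this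

theorem Env.Valid.of_add {σ : Store} {Γ Δ : Env} (h : Env.Valid σ (Γ + Δ)) : Env.Valid σ Δ := by
  induction Γ using Multiset.induction with
  | empty => rwa [zero_add] at h
  | cons p Γ ih =>
    rw [Multiset.cons_add] at h
    exact ih h.of_cons

/-- Validity travels from the conclusion of structural rules to their premise, the direction in
which inversion uses them. -/
theorem Structural.valid {σ : Store} {Γ Δ : Env} (h : Structural Γ Δ) (hΓ : Env.Valid σ Γ) :
    Env.Valid σ Δ := by
  induction h with
  | refl => exact hΓ
  | @con Γ Δ k T T₁ T₂ hs _ ih =>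
    have := Env.Valid.replace (M := {T}) (N := {T₁, T₂}) hΓ (Multiset.singleton_ne_zero T)
      fun h => by simpa using h.split hs
    exact ih (by simpa using this)
  | weak _ ih => exact ih hΓ.of_cons
  | sub _ hs ih => exact ih (hΓ.replace_cons fun h => h.sub hs)
  | rev _ ih =>
    exact ih (hΓ.replace_cons fun h =>
      coherent_cons_unq_zero.2 (coherent_cons_unq_zero.1 h))

theorem Env.types_subst_shiftChan (k : Key) (Γ : Env) :
    Env.types (k.subst shiftChan) (Env.subst shiftChan Γ) = Env.types k Γ := by
  refine Env.types_map ?_ k Γ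
  rintro ((c | x) | X) ((d | y) | Y) h <;> simp_all [Key.subst, shiftChan]

theorem Env.types_zero_subst_shiftChan (Γ : Env) :
    Env.types (.id (.chan 0)) (Env.subst shiftChan Γ) = 0 := by
  refine Env.types_eq_zero.2 fun h => ?_
  obtain ⟨d, hd, _⟩ := Env.exists_mem_of_subst_shiftChan h
  exact absurd hd.symm (Nat.succ_ne_zero d)

/-- Shifted assumptions never concern the new channel, so its state is immaterial. -/
theorem Env.valid_subst_shiftChan_iff {σ : Store} {s : CState} {Γ : Env} :
    Env.Valid (σ.cons s) (Env.subst shiftChan Γ) ↔ Env.Valid σ Γ := by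
  constructor
  · intro h
    refine ⟨fun k => ?_, fun c T hT => ?_⟩
    · rw [← Env.types_subst_shiftChan]
      exact h.coherent _
    · exact h.allocated (c + 1) T (Multiset.mem_map.2 ⟨_, hT, rfl⟩)
  · intro h
    refine ⟨fun k => ?_, fun c T hT => ?_⟩
    · have hk : k = .id (.chan 0) ∨ ∃ k', k = Key.subst shiftChan k' := by
        rcases k with ((_ | c) | x) | X
        · exact .inl rfl
        · exact .inr ⟨.id (.chan c), rfl⟩
        · exact .inr ⟨.id (.var x), rfl⟩
        · exact .inr ⟨.pvar X, rfl⟩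
      rcases hk with rfl | ⟨k, rfl⟩
      · rw [Env.types_zero_subst_shiftChan]
        exact coherent_zero
      · rw [Env.types_subst_shiftChan]
        exact h.coherent k
    · obtain ⟨d, rfl, U, hU⟩ := Env.exists_mem_of_subst_shiftChan ⟨T, hT⟩
      exact h.allocated d U hU

theorem Env.Valid.resTop {σ : Store} {Γ : Env} (h : Env.Valid σ Γ) (T : Ty) :
    Env.Valid (σ.cons .top) ((.id (.chan 0), T) ::ₘ Env.subst shiftChan Γ) := by
  have h := Env.valid_subst_shiftChan_iff (s := .top).2 h
  refine ⟨fun k => ?_, fun c U hU => ?_⟩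
  · by_cases hk : Key.id (.chan 0) = k
    · subst hk
      rw [Env.types_cons_self, Env.types_zero_subst_shiftChan]
      exact coherent_singleton T
    · rw [Env.types_cons_of_ne hk]
      exact h.coherent k
  · rcases Multiset.mem_cons.1 hU with hU | hU
    · cases hU
      rfl
    · exact h.allocated c U hU

/-- Coherence leaves no other assumption about `c`, so nothing in `Γ` constrains its new state. -/
theorem Env.Valid.free {σ : Store} {Γ : Env} {c : ℕ} {Ts : List Ty} {s : CState}
    (h : Env.Valid σ ((.id (.chan c), .chan Ts (.unq 0)) ::ₘ Γ)) :
    Env.Valid (Function.update σ c (some s)) Γ := by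
  refine ⟨h.of_cons.coherent, fun d T hT => ?_⟩
  have hcd : d ≠ c := by
    rintro rfl
    have := h.coherent (.id (.chan d))
    rw [Env.types_cons_self, coherent_cons_unq_zero] at this
    exact Env.types_eq_zero.1 this ⟨T, hT⟩
  rw [Function.update_of_ne hcd]
  exact h.of_cons.allocated d T hT

theorem Env.Valid.use_unq {σ : Store} {k : Key} {Ts : List Ty} {i : ℕ} {Γ : Env}
    (h : Env.Valid σ ((k, .chan Ts (.unq (i + 1))) ::ₘ (k, .chan Ts .aff) ::ₘ Γ)) :
    Env.Valid σ ((k, .chan Ts (.unq i)) ::ₘ Γ) :=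
  Env.Valid.replace (M := {.chan Ts (.unq (i + 1)), .chan Ts .aff}) (N := {.chan Ts (.unq i)})
    (by simpa using h) (by simp) fun h => by simpa using (Coherent.use_unq (by simpa using h))

theorem Env.Valid.payload_eq {σ : Store} {k : Key} {Ts Ts' : List Ty} {a a' : Attr} {Γ : Env}
    (h : Env.Valid σ ((k, .chan Ts a) ::ₘ (k, .chan Ts' a') ::ₘ Γ)) : Ts = Ts' :=
  (h.coherent k).payload_eq (a := a) (b := a') (by simp [Env.mem_types]) (by simp [Env.mem_types])

/-- Both ends of a communication consume their use of the channel. -/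
theorem Env.Valid.uses {σ : Store} {u : Ident} {Ts : List Ty} {a a' : Attr}
    {Γ Γ' Δ Δ' Θ : Env}
    (h : Env.Valid σ ((.id u, .chan Ts a) ::ₘ (.id u, .chan Ts a') ::ₘ (Γ + Γ' + Θ)))
    (hu : Uses Γ u Ts a Δ) (hu' : Uses Γ' u Ts a' Δ') : Env.Valid σ (Δ + Δ' + Θ) := by
  have hc := h.coherent (.id u)
  rw [Env.types_cons_self, Env.types_cons_self] at hc
  cases hu with
  | aff =>
    cases hu' with
    | aff => exact h.of_cons.of_cons
    | unr =>
      rw [Multiset.add_cons, Multiset.cons_add]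
      exact h.of_cons
    | unq i =>
      rw [Multiset.add_cons, Multiset.cons_add]
      rw [Multiset.cons_swap] at h
      exact h.use_unq
  | unr =>
    rw [Multiset.cons_add, Multiset.cons_add]
    cases hu' with
    | aff =>
      rw [Multiset.cons_swap] at h
      exact h.of_cons
    | unr =>
      rw [Multiset.add_cons, Multiset.cons_add]
      exact h
    -- An unrestricted assumption cannot coexist with a unique one.
    | unq i => simpa using coherent_cons_unr.1 hc _ (Multiset.mem_cons_self _ _)
  | unq i =>
    rw [Multiset.cons_add, Multiset.cons_add]
    -- Every other assumption about a unique channel is affine, in particular the one used by the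
    -- communication partner.
    have hm : ∀ T, T ∈ Ty.chan Ts a' ::ₘ Env.types (.id u) (Γ + Γ' + Θ) → T = .chan Ts .aff := by
      obtain ⟨n, _, hn⟩ := coherent_cons_unq.1 hc
      rw [hn]
      exact fun T => Multiset.eq_of_mem_replicate
    have ha := hm _ (Multiset.mem_cons_self _ _)
    cases hu' with
    | aff => exact h.use_unq
    | unr => simp at ha
    | unq j => simp at ha

/-! ### Partial maps -/

theorem Env.IsPartialMap.coherent {Γ : Env} (h : Γ.IsPartialMap) (k : Key) :
    Coherent (Env.types k Γ) := by
  induction Γ using Multiset.induction with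
  | empty => exact coherent_zero
  | cons p Γ ih =>
    obtain ⟨k', T⟩ := p
    rw [Env.IsPartialMap, Multiset.map_cons, Multiset.nodup_cons] at h
    by_cases hk : k' = k
    · subst hk
      have h0 : Env.types k' Γ = 0 :=
        Env.types_eq_zero.2 fun ⟨U, hU⟩ => h.1 (Multiset.mem_map.2 ⟨_, hU, rfl⟩)
      rw [Env.types_cons_self, h0]
      exact coherent_singleton T
    · rw [Env.types_cons_of_ne hk]
      exact ih h.2

/-- The assumptions of a coherent environment arise from those of a partial map. -/
theorem Env.exists_isPartialMap (Γ : Env) (h : ∀ k, Coherent (Env.types k Γ)) :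
    ∃ Δ : Env, Structural Δ Γ ∧ Δ.IsPartialMap ∧ ∀ p ∈ Δ, ∃ T, (p.1, T) ∈ Γ := by
  induction Γ using Multiset.strongInductionOn with
  | ih Γ ih =>
    rcases Multiset.empty_or_exists_mem Γ with rfl | ⟨⟨k, U⟩, hU⟩
    · exact ⟨0, .refl _, Multiset.nodup_zero, fun p hp => absurd hp (Multiset.notMem_zero p)⟩
    -- Recursion on the environment with all assumptions about `k` removed; these are then replaced
    -- together by one assumption.
    · have hlt : Γ.filter (fun p => ¬ p.1 = k) < Γ :=
        lt_of_le_of_ne (Multiset.filter_le _ Γ) fun he =>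
          (Multiset.filter_eq_self.1 he _ hU) rfl
      obtain ⟨Δ, hs, hp, hm⟩ := ih _ hlt fun k' => by
        by_cases hk : k = k'
        · subst hk
          rw [Env.types_eq_zero.2]
          · exact coherent_zero
          · rintro ⟨T, hT⟩
            exact (Multiset.mem_filter.1 hT).2 rfl
        · have : Env.types k' (Γ.filter fun p => ¬ p.1 = k) = Env.types k' Γ := by
            rw [Env.types, Multiset.filter_filter, Env.types]
            refine congrArg _ (Multiset.filter_congr fun p _ => ?_)
            exact ⟨And.left, fun h => ⟨h, fun h' => hk (h' ▸ h)⟩⟩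
          rw [this]
          exact h k'
      obtain ⟨T, hT⟩ := (h k).exists_structural k
      refine ⟨(k, T) ::ₘ Δ, ?_, ?_, ?_⟩
      · rw [Env.map_types] at hT
        have := hT.add hs
        rwa [Multiset.filter_add_not, Multiset.singleton_add] at this
      · rw [Env.IsPartialMap, Multiset.map_cons, Multiset.nodup_cons]
        -- The control of the domain in the induction hypothesis shows that `k` does not reappear.
        refine ⟨fun hk => ?_, hp⟩
        obtain ⟨p, hp, he⟩ := Multiset.mem_map.1 hk
        obtain ⟨V, hV⟩ := hm p hp
        exact (Multiset.mem_filter.1 hV).2 he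
      · intro p hp
        rcases Multiset.mem_cons.1 hp with rfl | hp
        · exact ⟨U, hU⟩
        · obtain ⟨V, hV⟩ := hm p hp
          exact ⟨V, Multiset.mem_of_mem_filter hV⟩

/-! ### Subject reduction -/

theorem instArgs_comp_shiftVar (bs : List ℕ) : instArgs bs ∘ shiftVar bs.length = id := by
  funext u
  cases u <;> simp [instArgs, shiftVar]

theorem map_instArgs_range (bs : List ℕ) :
    ((List.range bs.length).map Ident.var).map (instArgs bs) = bs.map Ident.chan := by
  refine List.ext_getElem (by simp) fun i h₁ h₂ => ?_
  simp at h₂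
  simp [instArgs, h₂]

theorem instFresh_comp_shiftVar : instFresh ∘ shiftVar 1 = shiftChan := by
  funext u
  rcases u with c | x
  · rfl
  · simp [instFresh, shiftVar, shiftChan, Nat.add_comm 1 x]

theorem Typed.alloc_step {Γ : Env} {P : Proc} (h : Typed Γ (.alloc P)) :
    Typed Γ (.res .top (P.subst instFresh)) := by
  obtain ⟨Ts, hP⟩ := h.alloc_inv
  have := hP.subst instFresh
  rw [Env.subst_cons, Env.subst_subst, instFresh_comp_shiftVar] at this
  exact .resTop this

/-- Subject reduction for communication, with a frame `Θ`. -/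
theorem Typed.com_step {σ : Store} {Γ Θ : Env} {c : ℕ} {bs : List ℕ} {P Q : Proc}
    (h : Typed Γ (.par (.out (.chan c) (bs.map Ident.chan) P) (.inp (.chan c) bs.length Q)))
    (hv : Env.Valid σ (Γ + Θ)) :
    ∃ Γ', Typed Γ' (.par P (Q.subst (instArgs bs))) ∧ Env.Valid σ (Γ' + Θ) := by
  obtain ⟨Γ₁, Γ₂, hs, hP, hQ⟩ := h.par_inv
  obtain ⟨_, hs₁, Γ₁, Δ₁, Ts, a, hl, hu₁, hP, rfl⟩ := hP.inversion
  obtain ⟨_, hs₂, Γ₂, Δ₂, Us, b, hl', hu₂, hQ, rfl⟩ := hQ.inversion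
  have hv := ((hs.trans (hs₁.add hs₂)).add_right Θ).valid hv
  have he : ∀ p q : Key × Ty, p ::ₘ (Γ₁ + Env.args (bs.map Ident.chan) Ts) + q ::ₘ Γ₂ + Θ =
      p ::ₘ q ::ₘ (Γ₁ + Γ₂ + (Env.args (bs.map Ident.chan) Ts + Θ)) := by
    intro p q
    rw [Multiset.add_cons, Multiset.cons_add, Multiset.cons_add, Multiset.cons_add,
      Multiset.cons_swap]
    congr 2
    abel
  rw [he] at hv
  -- Both ends hold an assumption about the channel `c`, so their payload types coincide.
  obtain rfl := hv.payload_eq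
  -- The assumptions about the transmitted names pass from the sender to the receiver.
  refine ⟨Δ₁ + (Δ₂ + Env.args (bs.map Ident.chan) Ts), .par hP ?_, ?_⟩
  · have := hQ.subst (instArgs bs)
    rwa [← hl', Env.subst_add, Env.subst_subst, instArgs_comp_shiftVar, Env.subst_id,
      Env.subst_args, map_instArgs_range] at this
  · have := hv.uses hu₁ hu₂
    rwa [← add_assoc, add_assoc _ _ Θ]

/-- Restriction of a typing to the scope of the channel `0`. -/
theorem Typed.res_of_valid {σ : Store} {s : CState} {Γ Θ : Env} {P : Proc} (h : Typed Γ P)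
    (hv : Env.Valid (σ.cons s) (Γ + Env.subst shiftChan Θ)) :
    ∃ Γ', Typed Γ' (.res s P) ∧ Env.Valid σ (Γ' + Θ) := by
  have he := Env.subst_shiftChan_unshiftChan (Env.not_exists_mem_erase 0 Γ)
  refine ⟨Env.subst unshiftChan (Env.erase 0 Γ), ?_, ?_⟩
  · cases s with
    | top =>
      have hc := hv.coherent (.id (.chan 0))
      rw [Env.types_add, Env.types_zero_subst_shiftChan, add_zero] at hc
      -- The frame says nothing about channel `0`, so the assumptions of `Γ` about it are coherent
      -- by themselves and merge into a single type.
      obtain ⟨T, hT⟩ := hc.exists_structural (.id (.chan 0))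
      refine .resTop (T := T) ?_
      rw [he, ← Multiset.singleton_add]
      refine (hT.add_right _).typed ?_
      rwa [Env.map_types, Env.filter_add_erase]
    | bot =>
      refine .resBot ?_
      rw [he, Env.erase_eq_self]
      · exact h
      · rintro ⟨T, hT⟩
        -- Domain channels are allocated, so a deallocated scoped channel has no assumption, as the
        -- rule for it demands.
        have := hv.allocated 0 T (Multiset.mem_add.2 (.inl hT))
        simp [Store.cons] at this
  · rw [← Env.filter_add_erase 0 Γ, add_assoc] at hv
    have := hv.of_add
    rwa [← he, ← Env.subst_add, Env.valid_subst_shiftChan_iff] at this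

/-- Subject reduction with a frame `Θ`. -/
theorem Step.typed {C C' : Config} (h : Step C C') {Γ Θ : Env} (hP : Typed Γ C.proc)
    (hv : Env.Valid C.store (Γ + Θ)) :
    ∃ Γ', Typed Γ' C'.proc ∧ Env.Valid C'.store (Γ' + Θ) := by
  induction h generalizing Γ Θ with
  | com bs P Q _ => exact Typed.com_step hP hv
  | unfold σ P => exact ⟨Γ, Typed.unfold hP, hv⟩
  | thenBranch σ c P Q => exact ⟨Γ, (Typed.ite_inv hP).2.2.1, hv⟩
  | elseBranch σ P Q _ => exact ⟨Γ, (Typed.ite_inv hP).2.2.2, hv⟩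
  | alloc σ P => exact ⟨Γ, Typed.alloc_step hP, hv⟩
  | free P _ =>
    obtain ⟨Δ, hs, Γ', Ts, hP, rfl⟩ := hP.inversion
    have hv := (hs.add_right Θ).valid hv
    rw [Multiset.cons_add] at hv
    exact ⟨Γ', hP, hv.free⟩
  | struct hs _ hs' ih =>
    obtain ⟨Γ', hP', hv'⟩ := ih (hs.typed_iff.1 hP) hv
    exact ⟨Γ', hs'.typed_iff.1 hP', hv'⟩
  -- The environment of the inactive component joins the frame, so it remains coherent with the new
  -- environment of the active one.
  | parLeft Q _ ih =>
    obtain ⟨Γ₁, Γ₂, hs, hP, hQ⟩ := Typed.par_inv hP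
    have hv := (hs.add_right Θ).valid hv
    rw [add_assoc] at hv
    obtain ⟨Γ', hP', hv'⟩ := ih hP hv
    exact ⟨Γ' + Γ₂, .par hP' hQ, by rwa [add_assoc]⟩
  | parRight Q _ ih =>
    obtain ⟨Γ₁, Γ₂, hs, hQ, hP⟩ := Typed.par_inv hP
    have hv := (hs.add_right Θ).valid hv
    rw [add_comm Γ₁, add_assoc] at hv
    obtain ⟨Γ', hP', hv'⟩ := ih hP hv
    exact ⟨Γ₁ + Γ', .par hQ hP', by rwa [add_comm Γ₁, add_assoc]⟩
  | @res σ σ' s s' P P' _ ih =>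
    -- Opening the scope adds an assumption about the new channel exactly when it is allocated; the
    -- frame is shifted past it.
    have key : ∃ Δ, Typed Δ P ∧ Env.Valid (σ.cons s) (Δ + Env.subst shiftChan Θ) := by
      cases s with
      | top =>
        obtain ⟨T, hP⟩ := Typed.resTop_inv hP
        refine ⟨_, hP, ?_⟩
        rw [Multiset.cons_add, ← Env.subst_add]
        exact hv.resTop T
      | bot =>
        refine ⟨_, Typed.resBot_inv hP, ?_⟩
        rw [← Env.subst_add]
        exact Env.valid_subst_shiftChan_iff.2 hv
    obtain ⟨Δ, hP, hv⟩ := key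
    obtain ⟨Γ', hP', hv'⟩ := ih hP hv
    exact hP'.res_of_valid hv'

theorem Env.Valid.exists_typedConfig {σ : Store} {Γ : Env} {P : Proc} (h : Env.Valid σ Γ)
    (hP : Typed Γ P) : ∃ Γ', TypedConfig Γ' ⟨σ, P⟩ := by
  obtain ⟨Δ, hs, hp, hm⟩ := Γ.exists_isPartialMap h.coherent
  refine ⟨Δ, ⟨fun c hc => ?_, fun c T hT => ?_, hs.typed hP, hp⟩⟩
  · obtain ⟨T, hT⟩ := hP.exists_mem_of_mem_fn hc
    exact ⟨.top, h.allocated c T hT⟩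
  · obtain ⟨U, hU⟩ := hm _ hT
    exact h.allocated c U hU

end PiR

theorem mainTheorem1 (Γ : PiR.Env) (σ σ' : PiR.Store) (P P' : PiR.Proc)
    (hty : PiR.TypedConfig Γ ⟨σ, P⟩)
    (hred : PiR.Config.Reduces ⟨σ, P⟩ ⟨σ', P'⟩) :
    ∃ Γ' : PiR.Env, PiR.TypedConfig Γ' ⟨σ', P'⟩ := by
  -- At top level the frame is empty.
  obtain ⟨Γ', hP', hv⟩ := hred.2.2.typed (Θ := 0) hty.typed
    ⟨fun k => by rw [add_zero]; exact hty.partialMap.coherent k,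
      fun c T hT => hty.allocated c T (by rwa [add_zero] at hT)⟩
  rw [add_zero] at hv
  exact hv.exists_typedConfig hP'
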